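/- **Definitions.** A *ZX-diagram* (without inputs, with $n$ outputs) is a finite multigraph whose vertices are $Z$- or $X$-spiders with phase $0$ or $\pi$, together with $n$ output ends; its interpretation is the $n$-qubit vector obtained by contracting the tensors $|0\cdots0\rangle+e^{i\alpha}|1\cdots1\rangle$ ($Z$-spiders) and $|{+}\cdots{+}\rangle+e^{i\alpha}|{-}\cdots{-}\rangle$ ($X$-spiders). A *fault* $F$ on $D$ puts a Pauli operator on every edge of $D$, including the output edges; its weight is the number of non-identity Paulis, $D^F$ is the resulting diagram, and $F$ is *undetectable* if $D^F\neq 0$. Diagrams $D_1,D_2$ are *$w$-fault-equivalent* if for every undetectable fault $F_1$ on $D_1$ of weight less than $w$ there is a fault $F_2$ on $D_2$ of at most the same weight such that $D_1^{F_1}$ and $D_2^{F_2}$ have the same interpretation up to a non-zero scalar, and vice versa. $D$ *$t$-fault-tolerantly prepares the $n$-qubit CAT state* if it is $(t+1)$-fault-equivalent to the single $Z$-spider with $n$ output legs. A *generalised CNOT circuit* (without inputs) consists of CNOT gates, preparations of $|0\rangle$ and $|+\rangle$, single-qubit $Z$- and $X$-measurements, and Pauli $Z$ and $X$ corrections depending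 on earlier measurement outcomes, none being applied when all outcomes are $0$. It comes with a set of accepted outcomes containing the all-$0$ outcome, and it is deterministic: all accepted outcomes that can occur give the same output state up to a non-zero scalar. It $t$-fault-tolerantly prepares the CAT state if the phase-free ZX-diagram of its all-$0$ branch does. A *marked graph* is a finite multigraph (self-loops, parallel edges, and closed edges without vertices allowed) whose edges carry any number of marks. It is *$t$-robust* if, whenever its vertices and marks are divided into two parts by cutting edges in a total of $f\le t$ places (an edge may be cut several times, between its marks), one of the two parts contains at most $f$ marks. Let $r_t^n\in[0,\infty]$ be the minimum of (number of vertices)$/n$ over all $t$-robust 3-regular marked graphs with exactly $n$ marks ($\infty$ if there are none), and $r_t=\liminf_{n\to\infty}r_t^n$. **Proposition.** Let $t\ge1$. 1. For every $n\ge4$, every generalised CNOT circuit that $t$-fault-tolerantly prepares the $n$-qubit CAT state contains at least $n(r_t^n+1)+1$ CNOT gates. 2. Consequently, for every $n\ge4$ with $r_t\le r_t^n$, every such circuit contains at least $(r_t+1)n+1$ CNOT gates; and for every $r<r_t$, for all sufficiently large $n$, every such circuit contains at least $(r+1)n+1$ CNOT gates. -/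

import Mathlib

open Filter
open scoped ENNReal

namespace CatPrep

noncomputable section

/-! ### Single-qubit vectors and Pauli operators (computational basis labelled by `Bool`) -/

/-- The two kinds of spiders of the ZX-calculus. -/
inductive Colour
  | Z
  | X
  deriving DecidableEq

instance : Fintype Colour := ⟨{.Z, .X}, fun k => by cases k <;> simp⟩

/-- `ket Z false = |0⟩`, `ket Z true = |1⟩`, `ket X false = |+⟩`, `ket X true = |-⟩`,
as vectors of amplitudes. -/
def ket : Colour → Bool → Bool → ℂ
  | .Z, k, b => if b = k then 1 else 0
  | .X, k, b => (if k && b then -1 else 1) / (Real.sqrt 2 : ℂ)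

/-- Single-qubit Pauli operators, up to a global phase. -/
inductive Pauli
  | I
  | X
  | Y
  | Z
  deriving DecidableEq

/-- Matrix entries of the Pauli operators. -/
def Pauli.entry : Pauli → Bool → Bool → ℂ
  | .I, a, b => if a = b then 1 else 0
  | .X, a, b => if a = b then 0 else 1
  | .Y, a, b => if a = b then 0 else if a then Complex.I else -Complex.I
  | .Z, a, b => if a = b then (if a then -1 else 1) else 0

/-- The (unnormalised) vectors on `n` qubits. -/
abbrev QState (n : ℕ) : Type := (Fin n → Bool) → ℂ

/-- Two vectors are identified when they differ by a non-zero scalar. -/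
def SameUpToScalar {n : ℕ} (ψ φ : QState n) : Prop :=
  ∃ c : ℂ, c ≠ 0 ∧ ψ = c • φ

/-! ### Pauli ZX-diagrams without inputs -/

/-- A Pauli ZX-diagram with no inputs and `n` outputs. Multiple edges and self-loops are
allowed. An edge `e` has the two ends (half-edges) `(e, false)` and `(e, true)`, each attached
to a spider or to an output; every output is attached to exactly one half-edge.
The phase of a spider is `0` (`false`) or `π` (`true`). -/
structure ZXDiagram (n : ℕ) where
  Spider : Type
  Edge : Type
  [fintypeSpider : Fintype Spider]
  [fintypeEdge : Fintype Edge]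
  colour : Spider → Colour
  phase : Spider → Bool
  ends : Edge × Bool → Spider ⊕ Fin n
  output_unique : ∀ j : Fin n, ∃! h : Edge × Bool, ends h = Sum.inr j

attribute [instance] ZXDiagram.fintypeSpider ZXDiagram.fintypeEdge

namespace ZXDiagram

variable {n : ℕ}

/-- A fault places a Pauli operator on every edge. -/
abbrev Fault (D : ZXDiagram n) : Type := D.Edge → Pauli

/-- The weight of a fault: the number of edges carrying a non-identity Pauli. -/
def weight (D : ZXDiagram n) (F : D.Fault) : ℕ :=
  (Finset.univ.filter fun e => F e ≠ Pauli.I).card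

open Classical in
/-- The tensor of a spider: `|0…0⟩ + e^{ikπ}|1…1⟩` for a Z-spider and
`|+…+⟩ + e^{ikπ}|-…-⟩` for an X-spider, evaluated at the labels `a` of its legs. -/
def spiderTensor (D : ZXDiagram n) (s : D.Spider) (a : D.Edge × Bool → Bool) : ℂ :=
  (∏ h ∈ Finset.univ.filter (fun h => D.ends h = Sum.inl s), ket (D.colour s) false (a h)) +
    (if D.phase s then -1 else 1) *
      ∏ h ∈ Finset.univ.filter (fun h => D.ends h = Sum.inl s), ket (D.colour s) true (a h)

open Classical in
/-- The interpretation of the diagram `D^F`, obtained from `D` by placing the Paulis of `F` on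
its edges: the tensor network is contracted by summing over all labellings of the half-edges
that agree with the given labels `x` at the outputs. -/
def interp (D : ZXDiagram n) (F : D.Fault) : QState n := fun x =>
  ∑ a ∈ Finset.univ.filter
      (fun a : D.Edge × Bool → Bool => ∀ h j, D.ends h = Sum.inr j → a h = x j),
    (∏ e, (F e).entry (a (e, true)) (a (e, false))) * ∏ s, D.spiderTensor s a

/-- A fault is undetectable if it does not make the diagram zero. -/
def Undetectable (D : ZXDiagram n) (F : D.Fault) : Prop := D.interp F ≠ 0

/-- Every undetectable fault on `D₁` of weight less than `w` has the same effect as some fault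
on `D₂` of at most the same weight. -/
def FaultBounded (w : ℕ) (D₁ D₂ : ZXDiagram n) : Prop :=
  ∀ F₁ : D₁.Fault, D₁.Undetectable F₁ → D₁.weight F₁ < w →
    ∃ F₂ : D₂.Fault, D₂.weight F₂ ≤ D₁.weight F₁ ∧
      SameUpToScalar (D₁.interp F₁) (D₂.interp F₂)

/-- `w`-fault-equivalence of diagrams. -/
def FaultEquiv (w : ℕ) (D₁ D₂ : ZXDiagram n) : Prop :=
  FaultBounded w D₁ D₂ ∧ FaultBounded w D₂ D₁

/-- The `n`-qubit CAT state `|0…0⟩ + |1…1⟩` as a single Z-spider with `n` output legs. -/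
def cat (n : ℕ) : ZXDiagram n where
  Spider := Unit
  Edge := Fin n
  colour := fun _ => .Z
  phase := fun _ => false
  ends := fun h => if h.2 then Sum.inr h.1 else Sum.inl ()
  output_unique := by
    intro j
    refine ⟨(j, true), by simp, ?_⟩
    rintro ⟨e, b⟩ h
    cases b <;> simp_all

/-- A diagram `t`-fault-tolerantly prepares the `n`-qubit CAT state if it is
`(t+1)`-fault-equivalent to it. -/
def PreparesCat (t : ℕ) (D : ZXDiagram n) : Prop := FaultEquiv (t + 1) D (cat n)

/-- The empty diagram. -/
def empty : ZXDiagram 0 where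
  Spider := Empty
  Edge := Empty
  colour := fun s => s.elim
  phase := fun s => s.elim
  ends := fun h => h.1.elim
  output_unique := fun j => j.elim0

/-- Add a new last output, connected to a new phase-free 1-ary spider of colour `k`. -/
def addPrep (D : ZXDiagram n) (k : Colour) : ZXDiagram (n + 1) where
  Spider := Option D.Spider
  Edge := Option D.Edge
  colour := fun s => s.elim k D.colour
  phase := fun s => s.elim false D.phase
  ends := fun h => match h with
    | (some e, b) => Sum.map some Fin.castSucc (D.ends (e, b))
    | (none, false) => Sum.inl none
    | (none, true) => Sum.inr (Fin.last n)
  output_unique := by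
    intro j
    induction j using Fin.lastCases with
    | last =>
      refine ⟨(none, true), rfl, ?_⟩
      rintro ⟨e, b⟩ h
      rcases e with _ | e
      · cases b <;> simp_all
      · cases hd : D.ends (e, b) with
        | inl s => simp [hd] at h
        | inr i => simp [hd] at h
    | cast j =>
      obtain ⟨⟨e, b⟩, h, hu⟩ := D.output_unique j
      refine ⟨(some e, b), by simp [h], ?_⟩
      rintro ⟨e', b'⟩ h'
      rcases e' with _ | e'
      · cases b' <;> simp at h'
        exact absurd h'.symm (Fin.castSucc_lt_last j).ne
      · cases hd : D.ends (e', b') with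
        | inl s => simp [hd] at h'
        | inr i =>
          simp [hd] at h'
          subst h'
          have := hu _ hd
          simp_all

/-- Connect output `q` to a new phase-free 1-ary spider of colour `k`; the remaining outputs
keep their order. -/
def addEffect (D : ZXDiagram (n + 1)) (k : Colour) (q : Fin (n + 1)) : ZXDiagram n where
  Spider := Option D.Spider
  Edge := D.Edge
  colour := fun s => s.elim k D.colour
  phase := fun s => s.elim false D.phase
  ends := fun h => Sum.elim (fun s => Sum.inl (some s))
    (q.insertNth (α := fun _ => Option D.Spider ⊕ Fin n) (Sum.inl none) Sum.inr) (D.ends h)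
  output_unique := by
    intro j
    obtain ⟨h, hh, hu⟩ := D.output_unique (q.succAbove j)
    refine ⟨h, by simp [hh], ?_⟩
    intro h' hh'
    apply hu
    cases hd : D.ends h' with
    | inl s => simp [hd] at hh'
    | inr i =>
      simp only [hd, Sum.elim_inr] at hh'
      induction i using Fin.succAboveCases q with
      | x => simp at hh'
      | p i => simp at hh'; rw [hh']

/-- Append a CNOT gate with control output `c` and target output `t`: a phase-free Z-spider on
the control wire and a phase-free X-spider on the target wire, joined by an edge. -/
def addCNOT (D : ZXDiagram n) (c t : Fin n) (hct : c ≠ t) : ZXDiagram n where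
  Spider := D.Spider ⊕ Colour
  Edge := D.Edge ⊕ Option Colour
  colour := Sum.elim D.colour id
  phase := Sum.elim D.phase fun _ => false
  ends := fun h => match h with
    | (Sum.inl e, b) => Sum.elim (fun s => Sum.inl (Sum.inl s))
        (fun j => if j = c then Sum.inl (Sum.inr .Z) else
          if j = t then Sum.inl (Sum.inr .X) else Sum.inr j) (D.ends (e, b))
    | (Sum.inr none, b) => Sum.inl (Sum.inr (if b then .X else .Z))
    | (Sum.inr (some k), false) => Sum.inl (Sum.inr k)
    | (Sum.inr (some .Z), true) => Sum.inr c
    | (Sum.inr (some .X), true) => Sum.inr t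
  output_unique := by
    intro j
    have key : ∀ e b, (Sum.elim (fun s => Sum.inl (Sum.inl s))
        (fun j => if j = c then Sum.inl (Sum.inr Colour.Z) else
          if j = t then Sum.inl (Sum.inr Colour.X) else Sum.inr j) (D.ends (e, b)) :
          (D.Spider ⊕ Colour) ⊕ Fin n) = Sum.inr j →
        D.ends (e, b) = Sum.inr j ∧ j ≠ c ∧ j ≠ t := by
      intro e b h
      cases hd : D.ends (e, b) with
      | inl s => simp [hd] at h
      | inr i =>
        simp only [hd, Sum.elim_inr] at h
        split_ifs at h with h1 h2
        simp only [Sum.inr.injEq] at h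
        subst h
        exact ⟨rfl, h1, h2⟩
    by_cases hjc : j = c
    · subst hjc
      refine ⟨(Sum.inr (some .Z), true), rfl, ?_⟩
      rintro ⟨e | _ | k, b⟩ h
      · exact absurd rfl (key e b h).2.1
      · simp at h
      · cases b <;> cases k <;> simp_all
    · by_cases hjt : j = t
      · subst hjt
        refine ⟨(Sum.inr (some .X), true), rfl, ?_⟩
        rintro ⟨e | _ | k, b⟩ h
        · exact absurd rfl (key e b h).2.2
        · simp at h
        · cases b <;> cases k <;> simp_all
      · obtain ⟨⟨e, b⟩, h, hu⟩ := D.output_unique j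
        refine ⟨(Sum.inl e, b), by simp [h, hjc, hjt], ?_⟩
        rintro ⟨e' | _ | k, b'⟩ h'
        · have := hu _ (key e' b' h').1
          simp_all
        · simp at h'
        · cases b' <;> cases k <;> simp_all

end ZXDiagram

/-! ### Generalised CNOT circuits -/

/-- A circuit without inputs, with `m` measurements (in order of execution) and `n` output
qubits, built up one operation at a time. `prep .Z` and `prep .X` prepare a new last qubit in
`|0⟩` and `|+⟩`; `measure C k q` measures qubit `q` in the `k`-basis and discards it, the
remaining qubits keeping their order; `correct C k q f` applies the Pauli `k` to qubit `q` if
`f` of the outcomes so far is `true`, and nothing is to be corrected when all outcomes are 0. -/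
inductive Circuit : ℕ → ℕ → Type
  | nil : Circuit 0 0
  | prep {m n : ℕ} (C : Circuit m n) (k : Colour) : Circuit m (n + 1)
  | cnot {m n : ℕ} (C : Circuit m n) (c t : Fin n) (hct : c ≠ t) : Circuit m n
  | measure {m n : ℕ} (C : Circuit m (n + 1)) (k : Colour) (q : Fin (n + 1)) : Circuit (m + 1) n
  | correct {m n : ℕ} (C : Circuit m n) (k : Colour) (q : Fin n) (f : (Fin m → Bool) → Bool)
      (hf : f (fun _ => false) = false) : Circuit m n

namespace Circuit

/-- The number of CNOT gates. -/
def cnotCount : {m n : ℕ} → Circuit m n → ℕ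
  | _, _, nil => 0
  | _, _, prep C _ => C.cnotCount
  | _, _, cnot C _ _ _ => C.cnotCount + 1
  | _, _, measure C _ _ => C.cnotCount
  | _, _, correct C _ _ _ _ => C.cnotCount

/-- The unnormalised state prepared when the measurement outcomes are `o`. -/
def run : {m n : ℕ} → Circuit m n → (Fin m → Bool) → QState n
  | _, _, nil, _ => fun _ => 1
  | _, _, prep C k, o => fun x => C.run o (Fin.init x) * ket k false (x (Fin.last _))
  | _, _, cnot C c t _, o => fun x => C.run o (Function.update x t (xor (x t) (x c)))
  | _, _, measure C k q, o => fun x =>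
      ∑ b : Bool, ket k (o (Fin.last _)) b * C.run (Fin.init o) (q.insertNth (α := fun _ => Bool) b x)
  | _, _, correct C k q f _, o => fun x =>
      if f o then
        match k with
        | .X => C.run o (Function.update x q (!x q))
        | .Z => (if x q then -1 else 1) * C.run o x
      else C.run o x

/-- The associated diagram: the circuit post-selected on the all-0 measurement outcome.
`|0⟩`, `⟨0|` are 1-ary X-spiders and `|+⟩`, `⟨+|` are 1-ary Z-spiders. -/
def diagram : {m n : ℕ} → Circuit m n → ZXDiagram n
  | _, _, nil => ZXDiagram.empty
  | _, _, prep C .Z => C.diagram.addPrep .X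
  | _, _, prep C .X => C.diagram.addPrep .Z
  | _, _, cnot C c t hct => C.diagram.addCNOT c t hct
  | _, _, measure C .Z q => C.diagram.addEffect .X q
  | _, _, measure C .X q => C.diagram.addEffect .Z q
  | _, _, correct C _ _ _ _ => C.diagram

end Circuit

/-- A generalised CNOT circuit (without inputs) with `n` output qubits: a circuit of CNOT gates,
ancilla preparations, measurements and outcome-dependent Pauli corrections, with a set of
measurement outcomes that pass the post-selection, such that the same state is obtained for
every passing outcome that can occur. -/
structure GenCNOTCircuit (n : ℕ) where
  numMeas : ℕ
  circuit : Circuit numMeas n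
  allowed : Set (Fin numMeas → Bool)
  zero_allowed : (fun _ => false) ∈ allowed
  deterministic : ∀ o ∈ allowed, circuit.run o ≠ 0 →
    SameUpToScalar (circuit.run o) (circuit.run fun _ => false)

/-- The number of CNOT gates of a generalised CNOT circuit. -/
def GenCNOTCircuit.cnotCount {n : ℕ} (C : GenCNOTCircuit n) : ℕ := C.circuit.cnotCount

/-- The circuit `t`-fault-tolerantly prepares the `n`-qubit CAT state. -/
def GenCNOTCircuit.PreparesCat {n : ℕ} (t : ℕ) (C : GenCNOTCircuit n) : Prop :=
  C.circuit.diagram.PreparesCat t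

/-! ### Marked graphs and the vertex ratio -/

/-- A finite multigraph (self-loops and parallel edges allowed) with marks on its edges.
`ends e = none` means that `e` is a closed loop with no vertex on it. The `marks e` marks on an
edge `e` are numbered along `e`, starting from the first end if `e` has ends. -/
structure MarkedGraph where
  Vertex : Type
  Edge : Type
  [fintypeVertex : Fintype Vertex]
  [fintypeEdge : Fintype Edge]
  ends : Edge → Option (Vertex × Vertex)
  marks : Edge → ℕ

attribute [instance] MarkedGraph.fintypeVertex MarkedGraph.fintypeEdge

namespace MarkedGraph

open Classical in
/-- The degree of a vertex; a self-loop counts twice. -/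
def degree (G : MarkedGraph) (v : G.Vertex) : ℕ :=
  ∑ e, (G.ends e).elim 0 fun p => (if p.1 = v then 1 else 0) + (if p.2 = v then 1 else 0)

/-- Every vertex has degree 3. -/
def IsCubic (G : MarkedGraph) : Prop := ∀ v, G.degree v = 3

/-- The total number of marks. -/
def numMarks (G : MarkedGraph) : ℕ := ∑ e, G.marks e

/-- A division of the vertices and marks into two parts, `true` and `false`. -/
structure Cut (G : MarkedGraph) where
  vertexSide : G.Vertex → Bool
  markSide : (e : G.Edge) → Fin (G.marks e) → Bool

/-- The number of consecutive pairs of different entries. -/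
def changes (l : List Bool) : ℕ := (l.zip l.tail).countP fun p => p.1 != p.2

/-- The number of places where an edge has to be cut: once between any two consecutive marks or
ends on different sides. Along a closed loop, the last mark is followed by the first. -/
def Cut.sizeAt {G : MarkedGraph} (K : G.Cut) (e : G.Edge) : ℕ :=
  match G.ends e with
  | some (u, v) =>
      changes (K.vertexSide u :: (List.ofFn (K.markSide e) ++ [K.vertexSide v]))
  | none => changes (List.ofFn (K.markSide e) ++ (List.ofFn (K.markSide e)).head?.toList)

/-- The total number of places where edges are cut. -/
def Cut.size {G : MarkedGraph} (K : G.Cut) : ℕ := ∑ e, K.sizeAt e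

/-- The number of marks in the part `b`. -/
def Cut.marksIn {G : MarkedGraph} (K : G.Cut) (b : Bool) : ℕ :=
  ∑ e, (Finset.univ.filter fun i => K.markSide e i = b).card

/-- `t`-robustness: whenever the graph is cut in `f ≤ t` places into two parts, at least one of
the parts contains at most `f` marks. -/
def IsRobust (t : ℕ) (G : MarkedGraph) : Prop :=
  ∀ K : G.Cut, K.size ≤ t → K.marksIn true ≤ K.size ∨ K.marksIn false ≤ K.size

/-- The vertex ratio: vertices per mark. -/
def vertexRatio (G : MarkedGraph) : ℝ≥0∞ := (Fintype.card G.Vertex : ℝ≥0∞) / (G.numMarks : ℝ≥0∞)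

end MarkedGraph

/-- `r_t^n`: the minimum vertex ratio of `t`-robust 3-regular marked graphs with `n` marks
(`⊤` if there were none; for `n > 0` the infimum of a nonempty such set is attained,
the possible values being natural numbers divided by `n`). -/
def minVertexRatio (t n : ℕ) : ℝ≥0∞ :=
  sInf {r | ∃ G : MarkedGraph, G.IsCubic ∧ G.IsRobust t ∧ G.numMarks = n ∧ r = G.vertexRatio}

/-- `r_t`: the optimal vertex ratio at fault-weight `t`. -/
def optVertexRatio (t : ℕ) : ℝ≥0∞ := liminf (fun n => minVertexRatio t n) atTop

end

end CatPrep

/-!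
The state prepared by the diagram `D` of the circuit is, up to a scalar, the CAT state, so its
amplitude at the all-`true` labelling is nonzero and comes from a labelling `u` of the half-edges
that satisfies all local conditions: either all legs of a Z-spider are labelled `true`, or none,
and an even number, hence zero or two, of the at most three legs of an X-spider. The edges labelled
`true` form a multigraph, the *highlighted graph*, in which the outputs are leaves, the X-spiders
are at most interior points of edges, and only control spiders of CNOT gates have degree three.

A cut of the highlighted graph gives a fault with a Pauli X on every edge that is cut. Amplitudes
of a phase-free diagram with bit flips are sums of nonnegative terms, so nothing cancels: the fault
is undetectable and flips exactly the outputs on one side of the cut. A fault on the CAT state with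
that effect has a weight of at least the number of outputs on one of the sides, so that the
highlighted graph, with the outputs as marks, is robust (`ZXDiagram.PreparesCat.robust`).

It is turned into a cubic marked graph in two stages. Contracting a leaf into its neighbour, which
inherits its weight, keeps robustness and does not increase the potential `#(vertices of degree
three) - #(leaves of weight one)` (`Admissible.contract`); robustness together with `n ≥ 4` keeps
weights from accumulating. When no leaves remain, the vertices of degree two are smoothed, those of
weight one becoming marks (`exists_smooth`). The initial potential is the number of highlighted
control spiders minus `n`, which gives `#vertices + n ≤ #CNOT`.

The extra `1` comes from the first CNOT gate. Its control spider is joined directly to a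
preparation. If it is not highlighted, then not all control spiders have been counted; otherwise
that preparation is a leaf of weight zero at a vertex of degree three, and contracting it lowers the
potential.
-/

namespace CatPrep

open MarkedGraph

/-! ### Colour changes along a list -/

theorem changes_cons_cons (a b : Bool) (l : List Bool) :
    changes (a :: b :: l) = (if a = b then 0 else 1) + changes (b :: l) := by
  cases a <;> cases b <;> simp [changes, add_comm]

theorem changes_singleton (a : Bool) : changes [a] = 0 := by simp [changes]

theorem changes_append_cons (l l' : List Bool) (a : Bool) :
    changes (l ++ a :: l') = changes (l ++ [a]) + changes (a :: l') := by
  induction l with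
  | nil => simp [changes_singleton]
  | cons b l ih =>
    cases l with
    | nil => simp [changes_cons_cons, changes_singleton]
    | cons c l =>
      simp only [List.cons_append, changes_cons_cons] at ih ⊢
      omega

theorem changes_reverse (l : List Bool) : changes l.reverse = changes l := by
  induction l with
  | nil => rfl
  | cons a l ih =>
    cases l with
    | nil => rfl
    | cons b l =>
      rw [changes_cons_cons, ← ih, List.reverse_cons, List.reverse_cons, List.append_assoc,
        List.singleton_append, changes_append_cons]
      simp only [changes_cons_cons, changes_singleton]
      simp only [eq_comm, add_comm, zero_add]

/-- An entry that repeats its predecessor creates no change. -/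
theorem exists_changes_insert (a : Bool) (l l' : List Bool) :
    ∃ s, changes (a :: (l ++ s :: l')) = changes (a :: (l ++ l')) := by
  induction l generalizing a with
  | nil => exact ⟨a, by simp [changes_cons_cons]⟩
  | cons b l ih =>
    obtain ⟨s, hs⟩ := ih b
    exact ⟨s, by simp [changes_cons_cons, hs]⟩

/-! ### Multigraphs whose edges carry marks -/

section Chains

variable {V : Type}

/-- An edge of a partially smoothed graph: its two ends, or `none` for a closed loop, and the
vertices that lie on it as marks, in order. -/
abbrev Chain (V : Type) : Type := Option (V × V) × List V

/-- The number of places where a two-colouring `σ` of all vertices, marks included, cuts a chain. -/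
def Chain.size (c : Chain V) (σ : V → Bool) : ℕ :=
  match c.1 with
  | some (u, w) => changes (σ u :: (c.2.map σ ++ [σ w]))
  | none => changes (c.2.map σ ++ (c.2.map σ).head?.toList)

/-- The number of places where a two-colouring cuts a multiset of chains. -/
def size (C : Multiset (Chain V)) (σ : V → Bool) : ℕ := (C.map fun c => c.size σ).sum

@[simp] theorem Chain.size_some (u w : V) (l : List V) (σ : V → Bool) :
    Chain.size (some (u, w), l) σ = changes (σ u :: (l.map σ ++ [σ w])) := rfl

@[simp] theorem Chain.size_none (l : List V) (σ : V → Bool) :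
    Chain.size (none, l) σ = changes (l.map σ ++ (l.map σ).head?.toList) := rfl

@[simp] theorem size_cons (c : Chain V) (C : Multiset (Chain V)) (σ : V → Bool) :
    size (c ::ₘ C) σ = c.size σ + size C σ := by simp [size]

section Degree

variable [DecidableEq V]

/-- The number of ends of a chain at the vertex `v`. -/
def Chain.deg (c : Chain V) (v : V) : ℕ :=
  c.1.elim 0 fun p => (if p.1 = v then 1 else 0) + (if p.2 = v then 1 else 0)

/-- The degree of a vertex in a multiset of chains. -/
def deg (C : Multiset (Chain V)) (v : V) : ℕ := (C.map fun c => c.deg v).sum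

@[simp] theorem Chain.deg_some (u w v : V) (l : List V) :
    Chain.deg (some (u, w), l) v = (if u = v then 1 else 0) + (if w = v then 1 else 0) := rfl

@[simp] theorem Chain.deg_none (l : List V) (v : V) : Chain.deg (none, l) v = 0 := rfl

/-- The number of occurrences of a vertex as a mark. -/
def markCount (C : Multiset (Chain V)) (v : V) : ℕ := (C.map fun c => c.2.count v).sum

@[simp] theorem deg_cons (c : Chain V) (C : Multiset (Chain V)) (v : V) :
    deg (c ::ₘ C) v = c.deg v + deg C v := by simp [deg]

@[simp] theorem markCount_cons (c : Chain V) (C : Multiset (Chain V)) (v : V) :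
    markCount (c ::ₘ C) v = c.2.count v + markCount C v := by simp [markCount]

theorem exists_cons_of_deg_pos {C : Multiset (Chain V)} {v : V} (h : deg C v ≠ 0) :
    ∃ c C', C = c ::ₘ C' ∧ c.deg v ≠ 0 := by
  by_contra! H
  apply h
  unfold deg
  apply Multiset.sum_eq_zero
  intro x hx
  obtain ⟨c, hc, rfl⟩ := Multiset.mem_map.1 hx
  obtain ⟨C', rfl⟩ := Multiset.exists_cons_of_mem hc
  exact H c C' rfl

/-- Recolouring a vertex that does not occur on a chain does not change its cut size. -/
theorem Chain.size_update {c : Chain V} {v : V} (h : c.deg v = 0) (h' : c.2.count v = 0)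
    (σ : V → Bool) (b : Bool) : c.size (Function.update σ v b) = c.size σ := by
  obtain ⟨p, l⟩ := c
  have hl : l.map (Function.update σ v b) = l.map σ := by
    apply List.map_congr_left
    intro a ha
    rw [Function.update_of_ne]
    rintro rfl
    exact (List.count_pos_iff.2 ha).ne' h'
  rcases p with _ | ⟨u, w⟩
  · simp [Chain.size, hl]
  · have hu : u ≠ v := by rintro rfl; simp [Chain.deg] at h
    have hw : w ≠ v := by rintro rfl; simp [Chain.deg] at h
    simp [Chain.size, hl, Function.update_of_ne, hu, hw]

theorem size_update {C : Multiset (Chain V)} {v : V} (h : deg C v = 0) (h' : markCount C v = 0)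
    (σ : V → Bool) (b : Bool) : size C (Function.update σ v b) = size C σ := by
  induction C using Multiset.induction with
  | empty => rfl
  | cons c C ih =>
    simp only [deg_cons, markCount_cons, Nat.add_eq_zero_iff] at h h'
    rw [size_cons, size_cons, ih h.2 h'.2, Chain.size_update h.1 h'.1]

/-- Chains that are interchangeable in all counts. -/
structure Chain.Equiv (c c' : Chain V) : Prop where
  size_eq : ∀ σ, c.size σ = c'.size σ
  deg_eq : ∀ v, c.deg v = c'.deg v
  count_eq : ∀ v, c.2.count v = c'.2.count v

theorem Chain.equiv_reverse (u w : V) (l : List V) :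
    Chain.Equiv (some (u, w), l) (some (w, u), l.reverse) where
  size_eq σ := by
    simp only [Chain.size]
    rw [← changes_reverse]
    simp
  deg_eq v := by simp [Chain.deg, add_comm]
  count_eq v := by simp

theorem Chain.exists_equiv_left {c : Chain V} {v : V} (h : c.deg v ≠ 0) :
    ∃ w l, Chain.Equiv c (some (v, w), l) := by
  obtain ⟨_ | ⟨u, w⟩, l⟩ := c
  · simp [Chain.deg] at h
  · by_cases hu : u = v
    · subst hu
      exact ⟨w, l, fun _ => rfl, fun _ => rfl, fun _ => rfl⟩
    · have hw : w = v := by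
        by_contra hw
        simp [Chain.deg, hu, hw] at h
      subst hw
      exact ⟨u, _, Chain.equiv_reverse _ _ _⟩

theorem Chain.exists_equiv_right {c : Chain V} {v : V} (h : c.deg v ≠ 0) :
    ∃ u l, Chain.Equiv c (some (u, v), l) := by
  obtain ⟨w, l, h1⟩ := Chain.exists_equiv_left h
  have h2 := Chain.equiv_reverse v w l
  exact ⟨w, l.reverse, fun σ => (h1.1 σ).trans (h2.1 σ), fun σ => (h1.2 σ).trans (h2.2 σ),
    fun σ => (h1.3 σ).trans (h2.3 σ)⟩

end Degree

/-! ### Robustness of weighted graphs and smoothing -/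

/-- The total weight of the vertices coloured `b`. -/
def weightIn [Fintype V] (wt : V → ℕ) (σ : V → Bool) (b : Bool) : ℕ :=
  ∑ v, if σ v = b then wt v else 0

/-- Robustness of a vertex-weighted graph, given by its cut-size function: a cut in `f ≤ t` places
leaves weight at most `f` on one side. -/
def RobustFor [Fintype V] (t : ℕ) (s : (V → Bool) → ℕ) (wt : V → ℕ) : Prop :=
  ∀ σ, s σ ≤ t → weightIn wt σ true ≤ s σ ∨ weightIn wt σ false ≤ s σ

theorem RobustFor.transfer [Fintype V] {t : ℕ} {s s' : (V → Bool) → ℕ} {wt wt' : V → ℕ}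
    (h : RobustFor t s wt)
    (H : ∀ σ, ∃ σ', s σ' = s' σ ∧ ∀ b, weightIn wt σ' b = weightIn wt' σ b) :
    RobustFor t s' wt' := by
  intro σ hσ
  obtain ⟨σ', h1, h2⟩ := H σ
  have := h σ' (h1 ▸ hσ)
  rwa [h1, h2, h2] at this

variable [DecidableEq V]

theorem weightIn_update [Fintype V] {wt : V → ℕ} {v : V} (h : wt v = 0) (σ : V → Bool)
    (s b : Bool) :
    weightIn wt (Function.update σ v s) b = weightIn wt σ b := by
  apply Finset.sum_congr rfl
  intro x _
  by_cases hx : x = v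
  · subst hx; simp [h]
  · simp [hx]

/-- What a smoothed vertex leaves on its chain: a mark, or nothing if it has weight zero. -/
def markOf (wt : V → ℕ) (v : V) : List V := if wt v = 0 then [] else [v]

/-- A vertex of degree two is removed by joining the chains that end there; it becomes a mark if
it has weight one. The condition on `markCount` says that the vertices already removed, and only
those, lie on the chains as marks according to their weight. -/
theorem exists_smooth [Fintype V] {t : ℕ} {C : Multiset (Chain V)} {wt : V → ℕ}
    (hwt : ∀ v, wt v ≤ 1)
    (hC : ∀ v, markCount C v = if deg C v = 0 then wt v else 0)
    (hR : RobustFor t (size C) wt) {v : V} (hv : deg C v = 2) :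
    ∃ C' : Multiset (Chain V), (∀ v, markCount C' v = if deg C' v = 0 then wt v else 0) ∧
      RobustFor t (size C') wt ∧ deg C' v = 0 ∧ ∀ x, x ≠ v → deg C' x = deg C x := by
  have hcv := hC v
  rw [if_neg (by omega)] at hcv
  obtain ⟨c, C', rfl, hc⟩ := exists_cons_of_deg_pos (C := C) (v := v) (by omega)
  -- Any `D` with the right degrees, marks and cut sizes will do. If `v` has weight zero, it is no
  -- longer coloured, and a colour that creates no further cut has to be supplied for it.
  have fin : ∀ D : Multiset (Chain V), deg D v = 0 → (∀ x, x ≠ v → deg D x = deg (c ::ₘ C') x) →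
      (∀ x, markCount D x = markCount (c ::ₘ C') x + (markOf wt v).count x) →
      (wt v ≠ 0 → ∀ σ, size (c ::ₘ C') σ = size D σ) →
      (wt v = 0 → ∀ σ, ∃ s, size (c ::ₘ C') (Function.update σ v s) = size D σ) →
      ∃ C'' : Multiset (Chain V), (∀ v, markCount C'' v = if deg C'' v = 0 then wt v else 0) ∧
      RobustFor t (size C'') wt ∧ deg C'' v = 0 ∧ ∀ x, x ≠ v → deg C'' x = deg (c ::ₘ C') x := by
    intro D h1 h2 h3 h4 h5
    refine ⟨D, ?_, ?_, h1, h2⟩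
    · intro x
      by_cases hx : x = v
      · subst hx
        rw [h3, hcv, if_pos h1, markOf]
        have := hwt x
        split_ifs with h0
        · simp [h0]
        · simp; omega
      · rw [h2 x hx, h3, hC, markOf]
        split_ifs <;> simp [Ne.symm hx]
    · apply hR.transfer
      intro σ
      by_cases h0 : wt v = 0
      · obtain ⟨s, hs⟩ := h5 h0 σ
        exact ⟨_, hs, fun b => weightIn_update h0 _ _ _⟩
      · exact ⟨σ, h4 h0 σ, fun _ => rfl⟩
  obtain ⟨u, l, e1⟩ := Chain.exists_equiv_right hc
  simp only [deg_cons, markCount_cons, Nat.add_eq_zero_iff] at hv hcv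
  have hl0 : ∀ σ : V → Bool, ∀ s, l.map (Function.update σ v s) = l.map σ := by
    intro σ s
    apply List.map_congr_left
    intro a ha
    rw [Function.update_of_ne]
    rintro rfl
    have := e1.3 a
    have := (List.count_pos_iff.2 ha).ne'
    simp_all
  by_cases hu : u = v
  -- both ends at `v` belong to the same chain, which closes up
  · subst hu
    have hd : deg C' u = 0 := by
      have := e1.2 u
      simp at this
      omega
    apply fin ((none, markOf wt u ++ l) ::ₘ C')
    · simp [hd]
    · intro x hx
      simp [e1.2, Ne.symm hx]
    · intro x
      simp [e1.3]; omega
    · intro h0 σ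
      simp [e1.1, markOf, h0]
    · intro h0 σ
      simp only [size_cons, e1.1, size_update hd hcv.2]
      simp only [Chain.size_none, Chain.size_some, markOf, h0, if_true, hl0, List.nil_append]
      cases l with
      | nil => exact ⟨true, by simp [changes]⟩
      | cons a l =>
        refine ⟨σ a, ?_⟩
        simp [changes_cons_cons]
  -- the ends at `v` belong to two chains, which are joined
  · have hc1 : c.deg v = 1 := by
      rw [e1.2]; simp [hu]
    obtain ⟨c2, C'', rfl, hc2⟩ := exists_cons_of_deg_pos (C := C') (v := v) (by omega)
    obtain ⟨w, l2, e2⟩ := Chain.exists_equiv_left hc2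
    simp only [deg_cons, markCount_cons, Nat.add_eq_zero_iff] at hv hcv
    have hw : w ≠ v := by
      rintro rfl
      have := e2.2 w
      simp at this
      omega
    have hc21 : c2.deg v = 1 := by
      rw [e2.2]; simp [hw]
    have hd : deg C'' v = 0 := by omega
    have hl2 : ∀ σ : V → Bool, ∀ s, l2.map (Function.update σ v s) = l2.map σ := by
      intro σ s
      apply List.map_congr_left
      intro a ha
      rw [Function.update_of_ne]
      rintro rfl
      have := e2.3 a
      have := (List.count_pos_iff.2 ha).ne'
      simp_all
    have join : ∀ σ : V → Bool, c.size σ + (c2.size σ + size C'' σ) =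
        changes (σ u :: (l.map σ ++ σ v :: (l2.map σ ++ [σ w]))) + size C'' σ := by
      intro σ
      have := changes_append_cons (σ u :: l.map σ) (l2.map σ ++ [σ w]) (σ v)
      simp only [List.cons_append] at this
      rw [e1.1, e2.1, this]
      simp only [Chain.size_some]
      omega
    apply fin ((some (u, w), l ++ markOf wt v ++ l2) ::ₘ C'')
    · simp [hd, hu, hw]
    · intro x hx
      simp [e1.2, e2.2, Ne.symm hx]; omega
    · intro x
      simp [e1.3, e2.3]; omega
    · intro h0 σ
      simp only [size_cons]
      rw [join]
      simp [markOf, h0]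
    · intro h0 σ
      obtain ⟨s, hs⟩ := exists_changes_insert (σ u) (l.map σ) (l2.map σ ++ [σ w])
      refine ⟨s, ?_⟩
      simp only [size_cons]
      rw [join, hl0, hl2, size_update hd hcv.2.2, Function.update_self, Function.update_of_ne hu,
        Function.update_of_ne hw, hs]
      simp [markOf, h0]

end Chains

/-! ### From chains to marked graphs -/

theorem card_filter_get_eq_count {α : Type} [DecidableEq α] (l : List α) (v : α) :
    (Finset.univ.filter fun k : Fin l.length => l.get k = v).card = l.count v := by
  induction l with
  | nil => simp
  | cons a l ih =>
    rw [Finset.card_filter] at ih ⊢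
    have := Fin.sum_univ_succ fun k : Fin (a :: l).length => if (a :: l).get k = v then 1 else 0
    refine this.trans ?_
    rw [List.count_cons, ← ih, add_comm]
    by_cases h : a = v <;> simp [h]

theorem sum_get {α : Type} (l : List α) (f : α → ℕ) :
    ∑ i : Fin l.length, f (l.get i) = (l.map f).sum := by
  rw [← List.sum_ofFn]
  congr 1
  apply List.ext_get <;> simp

section MarkedGraphs

variable {V : Type} [Fintype V] [DecidableEq V]

theorem exists_smooth_all {t : ℕ} {wt : V → ℕ} (hwt : ∀ v, wt v ≤ 1) (C : Multiset (Chain V))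
    (hC : ∀ v, markCount C v = if deg C v = 0 then wt v else 0)
    (hR : RobustFor t (size C) wt) :
    ∃ C' : Multiset (Chain V), (∀ v, markCount C' v = if deg C' v = 0 then wt v else 0) ∧
      RobustFor t (size C') wt ∧ ∀ x, deg C' x = if deg C x = 2 then 0 else deg C x := by
  induction hk : (Finset.univ.filter fun v => deg C v = 2).card generalizing C with
  | zero =>
    refine ⟨C, hC, hR, fun x => ?_⟩
    have : x ∉ Finset.univ.filter fun v => deg C v = 2 := by
      rw [Finset.card_eq_zero.1 hk]; simp
    rw [if_neg (by simpa using this)]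
  | succ k ih =>
    obtain ⟨v, hv⟩ := Finset.card_pos.1 (k.succ_pos.trans_eq hk.symm)
    have hv2 : deg C v = 2 := by simpa using hv
    obtain ⟨C1, h1, h2, h3, h4⟩ := exists_smooth hwt hC hR hv2
    obtain ⟨C', h5, h6, h7⟩ := ih C1 h1 h2 (by
      have : (Finset.univ.filter fun v => deg C1 v = 2) =
          (Finset.univ.filter fun v => deg C v = 2).erase v := by
        ext x
        by_cases hx : x = v
        · subst hx; simp [h3]
        · simp [hx, h4 x hx]
      rw [this, Finset.card_erase_of_mem hv, hk]; rfl)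
    refine ⟨C', h5, h6, fun x => ?_⟩
    rw [h7]
    by_cases hx : x = v
    · subst hx; simp [h3, hv2]
    · simp [h4 x hx]

/-- A fully smoothed multiset of chains is a cubic marked graph. -/
theorem exists_markedGraph_of_chains {t : ℕ} {wt : V → ℕ} (hwt : ∀ v, wt v ≤ 1)
    {C : Multiset (Chain V)} (hm : ∀ v, markCount C v = wt v)
    (hR : RobustFor t (size C) wt) (hd : ∀ v, deg C v = 0 ∨ deg C v = 3)
    (h3 : ∀ v, deg C v = 3 → wt v = 0) :
    ∃ G : MarkedGraph, G.IsCubic ∧ G.IsRobust t ∧ G.numMarks = ∑ v, wt v ∧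
      Fintype.card G.Vertex = (Finset.univ.filter fun v => deg C v = 3).card := by
  obtain ⟨L, rfl⟩ := Quot.exists_rep C
  change ∀ v, markCount (L : Multiset (Chain V)) v = wt v at hm
  change RobustFor t (size (L : Multiset (Chain V))) wt at hR
  change ∀ v, deg (L : Multiset (Chain V)) v = 0 ∨ deg (L : Multiset (Chain V)) v = 3 at hd
  change ∀ v, deg (L : Multiset (Chain V)) v = 3 → wt v = 0 at h3
  change ∃ G : MarkedGraph, _ ∧ _ ∧ _ ∧
    _ = (Finset.univ.filter fun v => deg (L : Multiset (Chain V)) v = 3).card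
  have hdeg : ∀ v, deg (L : Multiset (Chain V)) v = ∑ i, (L.get i).deg v := by
    intro v; rw [sum_get L (fun c => c.deg v)]; simp [deg]
  have hsize : ∀ σ, size (L : Multiset (Chain V)) σ = ∑ i, (L.get i).size σ := by
    intro σ; rw [sum_get L (fun c => c.size σ)]; simp [size]
  have hmc : ∀ v, wt v = ∑ i, (L.get i).2.count v := by
    intro v; rw [sum_get L (fun c => c.2.count v), ← hm]; simp [markCount]
  have hend : ∀ i, ∀ p, (L.get i).1 = some p →
      deg (L : Multiset (Chain V)) p.1 = 3 ∧ deg (L : Multiset (Chain V)) p.2 = 3 := by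
    intro i p hp
    have key : ∀ v, p.1 = v ∨ p.2 = v → deg (L : Multiset (Chain V)) v = 3 := by
      intro v hv
      refine (hd v).resolve_left ?_
      rw [hdeg]
      intro h0
      have := (Finset.sum_eq_zero_iff.1 h0) i (Finset.mem_univ _)
      rw [Chain.deg, hp] at this
      simp at this
      tauto
    exact ⟨key _ (Or.inl rfl), key _ (Or.inr rfl)⟩
  let G : MarkedGraph :=
    { Vertex := {v // deg (L : Multiset (Chain V)) v = 3}
      Edge := Fin L.length
      ends := fun i => (L.get i).1.pmap (fun p hp => (⟨p.1, hp.1⟩, ⟨p.2, hp.2⟩)) (hend i)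
      marks := fun i => (L.get i).2.length }
  -- the vertex that sits at a given mark position; weights at most one make this injective
  let pos : (Σ i : Fin L.length, Fin (L.get i).2.length) → V := fun q => (L.get q.1).2.get q.2
  have hpos : ∀ v, (Finset.univ.filter fun q => pos q = v).card = wt v := by
    intro v
    rw [hmc, Finset.card_filter, Fintype.sum_sigma]
    refine Finset.sum_congr rfl fun i _ => ?_
    rw [← card_filter_get_eq_count, Finset.card_filter]
  have hinj : Function.Injective pos := by
    intro a b hab
    have := (hpos (pos b)).trans_le (hwt _)
    exact Finset.card_le_one.1 this a (by simp [hab]) b (by simp)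
  refine ⟨G, ?_, ?_, ?_, ?_⟩
  · rintro ⟨v, hv⟩
    refine Eq.trans ?_ hv
    rw [hdeg]
    unfold MarkedGraph.degree
    refine Finset.sum_congr rfl fun i _ => ?_
    rw [Chain.deg]
    simp only [G]
    generalize hend i = h
    revert h
    generalize (L.get i).1 = o
    intro h
    cases o with
    | none => rfl
    | some p => simp [Option.pmap]
  · intro K
    -- a cut of `G` colours the vertices of degree three directly and the others through the marks
    let mark : (Σ i : Fin L.length, Fin (L.get i).2.length) → Bool := fun q => K.markSide q.1 q.2
    let σ : V → Bool := fun v => if h : deg (L : Multiset (Chain V)) v = 3 then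
      K.vertexSide ⟨v, h⟩ else Function.extend pos mark (fun _ => false) v
    have hσ : ∀ q, σ (pos q) = mark q := by
      intro q
      have h0 : deg (L : Multiset (Chain V)) (pos q) ≠ 3 := by
        intro h
        have h1 := hpos (pos q)
        rw [h3 _ h, Finset.card_eq_zero] at h1
        have : q ∈ Finset.univ.filter fun q' => pos q' = pos q := by simp
        rw [h1] at this
        simp at this
      simp only [σ, h0, dif_neg, not_false_eq_true]
      exact hinj.extend_apply _ _ _
    have hlist : ∀ i, (L.get i).2.map σ = List.ofFn (K.markSide i) := by
      intro i
      apply List.ext_get (by simp [G])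
      intro k h1 h2
      have := hσ ⟨i, ⟨k, by simpa using h1⟩⟩
      simpa [pos, mark] using this
    have hK : size (L : Multiset (Chain V)) σ = K.size := by
      rw [hsize]
      unfold Cut.size
      refine Finset.sum_congr rfl fun i _ => ?_
      rw [Chain.size, Cut.sizeAt, hlist]
      simp only [G]
      generalize hend i = h
      revert h
      generalize (L.get i).1 = o
      intro h
      cases o with
      | none => rfl
      | some p => simp [σ, h]
    have hw : ∀ b, weightIn wt σ b = K.marksIn b := by
      intro b
      have h1 : K.marksIn b = ∑ q, if mark q = b then 1 else 0 := by
        rw [Fintype.sum_sigma]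
        refine Finset.sum_congr rfl fun i _ => ?_
        rw [Finset.card_filter]
      rw [h1, weightIn, ← Finset.sum_fiberwise (g := pos)]
      refine Finset.sum_congr rfl fun v _ => ?_
      trans ∑ q with pos q = v, if σ v = b then 1 else 0
      · rw [Finset.sum_const, smul_eq_mul, hpos]
        simp
      · refine Finset.sum_congr rfl fun q hq => ?_
        rw [← hσ, (Finset.mem_filter.1 hq).2]
    have := hR σ
    rwa [hK, hw, hw] at this
  · unfold numMarks
    simp only [hmc]
    rw [Finset.sum_comm]
    refine Finset.sum_congr rfl fun i _ => ?_
    simpa [G] using (Multiset.sum_count_eq_card (s := Finset.univ)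
      (m := ((L.get i).2 : Multiset V)) (by simp)).symm
  · rw [Fintype.card_subtype]

end MarkedGraphs

/-! ### Contraction of leaves -/

section LeafContraction

variable {V : Type}

/-- A multigraph without marks, as a multiset of chains. -/
def plain (E : Multiset (V × V)) : Multiset (Chain V) := E.map fun p => (some p, [])

@[simp] theorem plain_cons (p : V × V) (E : Multiset (V × V)) :
    plain (p ::ₘ E) = (some p, []) ::ₘ plain E := Multiset.map_cons _ _ _

@[simp] theorem Chain.size_edge (p : V × V) (σ : V → Bool) :
    Chain.size (some p, []) σ = if σ p.1 = σ p.2 then 0 else 1 := by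
  simp [Chain.size, changes_cons_cons, changes_singleton]

theorem weightIn_add [Fintype V] (wt : V → ℕ) (σ : V → Bool) :
    weightIn wt σ true + weightIn wt σ false = ∑ v, wt v := by
  rw [weightIn, weightIn, ← Finset.sum_add_distrib]
  refine Finset.sum_congr rfl fun v _ => ?_
  cases σ v <;> simp

variable [DecidableEq V]

@[simp] theorem markCount_plain (E : Multiset (V × V)) (v : V) : markCount (plain E) v = 0 := by
  induction E using Multiset.induction with
  | empty => rfl
  | cons p E ih => simp [ih]

theorem exists_edge_of_deg_eq_one {E : Multiset (V × V)} {o : V} (h : deg (plain E) o = 1) :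
    ∃ w p E', E = p ::ₘ E' ∧ w ≠ o ∧ (p = (o, w) ∨ p = (w, o)) := by
  obtain ⟨c, C', h1, h2⟩ := exists_cons_of_deg_pos (C := plain E) (v := o) (by omega)
  have : c ∈ plain E := by rw [h1]; simp
  obtain ⟨⟨a, b⟩, hp, rfl⟩ := Multiset.mem_map.1 this
  obtain ⟨E', rfl⟩ := Multiset.exists_cons_of_mem hp
  simp only [plain_cons, deg_cons, Chain.deg_some] at h h2
  by_cases ha : a = o
  · subst ha
    refine ⟨b, _, E', rfl, ?_, Or.inl rfl⟩
    rintro rfl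
    simp at h
    omega
  · refine ⟨a, _, E', rfl, ha, Or.inr ?_⟩
    by_cases hb : b = o
    · rw [hb]
    · simp [ha, hb] at h2

/-- Separating an isolated vertex `o` and a vertex `w` from the rest cuts at most the edges
at `w`. -/
theorem size_plain_indicator_le (E : Multiset (V × V)) (o w : V) (ho : deg (plain E) o = 0) :
    size (plain E) (fun x => decide (x = o ∨ x = w)) ≤ deg (plain E) w := by
  induction E using Multiset.induction with
  | empty => simp [plain, size]
  | cons p E ih =>
    obtain ⟨a, b⟩ := p
    simp only [plain_cons, deg_cons, size_cons, Chain.size_edge, Chain.deg_some,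
      Nat.add_eq_zero_iff] at ho ⊢
    have hao : a ≠ o := by rintro rfl; simp at ho
    have hbo : b ≠ o := by rintro rfl; simp at ho
    refine add_le_add ?_ (ih ho.2)
    by_cases h1 : a = w <;> by_cases h2 : b = w <;> simp [hao, hbo, h1, h2]

variable [Fintype V]

/-- The potential that leaf contraction does not increase: the number of vertices of degree three
minus the number of leaves of weight one. -/
def potential (C : Multiset (Chain V)) (wt : V → ℕ) : ℤ :=
  ∑ v, ((if deg C v = 3 then 1 else 0) - if deg C v = 1 ∧ wt v = 1 then 1 else 0)

/-- The conditions on a vertex-weighted multigraph that are kept by leaf contraction. -/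
structure Admissible (t n : ℕ) (E : Multiset (V × V)) (wt : V → ℕ) : Prop where
  weight_le : ∀ v, wt v ≤ 1
  deg_le : ∀ v, deg (plain E) v ≤ 3
  weight_eq_zero : ∀ v, deg (plain E) v = 3 → wt v = 0
  robust : RobustFor t (size (plain E)) wt
  sum_weight : ∑ v, wt v = n

/-- Contraction of a leaf `o` into its neighbour `w`, which takes over the weight of `o`. The
potential drops when a leaf of weight zero is contracted into a vertex of degree three. -/
theorem Admissible.contract {t n : ℕ} (ht : 1 ≤ t) (hn : 4 ≤ n) {E : Multiset (V × V)} {wt : V → ℕ}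
    {o w : V} (hwo : w ≠ o) {p : V × V} (hp : p = (o, w) ∨ p = (w, o))
    (h : Admissible t n (p ::ₘ E) wt) (ho : deg (plain (p ::ₘ E)) o = 1) :
    ∃ wt', Admissible t n E wt' ∧
      potential (plain E) wt' + (if deg (plain (p ::ₘ E)) w = 3 ∧ wt o = 0 then 1 else 0) ≤
        potential (plain (p ::ₘ E)) wt := by
  have hpd : ∀ x, Chain.deg (some p, []) x =
      (if o = x then 1 else 0) + (if w = x then 1 else 0) := by
    intro x
    rcases hp with rfl | rfl
    · simp
    · simp [add_comm]
  have hps : ∀ σ : V → Bool, Chain.size (some p, []) σ = if σ o = σ w then 0 else 1 := by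
    intro x
    rcases hp with rfl | rfl
    · simp
    · simp [eq_comm]
  have hdeg : ∀ x, deg (plain (p ::ₘ E)) x =
      (if o = x then 1 else 0) + (if w = x then 1 else 0) + deg (plain E) x := by
    intro x; rw [plain_cons, deg_cons, hpd]
  have hsize : ∀ σ, size (plain (p ::ₘ E)) σ =
      (if σ o = σ w then 0 else 1) + size (plain E) σ := by
    intro x; rw [plain_cons, size_cons, hps]
  have hdo : deg (plain E) o = 0 := by
    have := hdeg o
    rw [ho, if_pos rfl, if_neg hwo] at this
    omega
  have hdw : deg (plain (p ::ₘ E)) w = 1 + deg (plain E) w := by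
    have := hdeg w
    simpa [hwo.symm] using this
  have hdx : ∀ x, x ≠ o → x ≠ w → deg (plain (p ::ₘ E)) x = deg (plain E) x := by
    intro x h1 h2
    rw [hdeg]; simp [h1.symm, h2.symm]
  -- Robustness, applied to the cut that separates `o` and `w` from the rest, bounds the weight that
  -- accumulates at `w`.
  have hacc : wt o + wt w ≤ max (deg (plain E) w) 1 ∧ (deg (plain E) w = 0 → wt o + wt w = 0) := by
    have h3 := h.deg_le w
    have ho1 := h.weight_le o
    have hw1 := h.weight_le w
    by_cases hdw2 : deg (plain E) w = 2
    · have := h.weight_eq_zero w (by omega)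
      omega
    · set σ : V → Bool := fun x => decide (x = o ∨ x = w) with hσ
      have h4 := hsize σ
      have h5 : size (plain E) σ ≤ _ := size_plain_indicator_le E o w hdo
      have h6 : σ o = σ w := by simp [hσ]
      rw [if_pos h6] at h4
      have h7 := h.robust σ (by omega)
      have h8 := weightIn_add wt σ
      rw [h.sum_weight] at h8
      have h9 : weightIn wt σ true = wt o + wt w := by
        rw [weightIn, ← Finset.sum_pair hwo.symm, ← Finset.sum_filter]
        refine Finset.sum_congr ?_ fun _ _ => rfl
        ext x; simp [hσ]
      omega
  let wt' : V → ℕ := Function.update (Function.update wt w (wt o + wt w)) o 0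
  have hw'o : wt' o = 0 := by simp [wt']
  have hw'w : wt' w = wt o + wt w := by simp [wt', hwo]
  have hw'x : ∀ x, x ≠ o → x ≠ w → wt' x = wt x := by
    intro x h1 h2
    simp [wt', h1, h2]
  have hsumf : ∀ f g : V → ℕ, (∀ x, x ≠ o → x ≠ w → f x = g x) → f o + f w = g o + g w →
      ∑ x, f x = ∑ x, g x := by
    intro f g h1 h2
    rw [← Finset.sum_add_sum_compl {o, w}, ← Finset.sum_add_sum_compl {o, w} g,
      Finset.sum_pair hwo.symm, Finset.sum_pair hwo.symm, h2]
    congr 1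
    refine Finset.sum_congr rfl fun x hx => ?_
    simp at hx
    exact h1 x hx.1 hx.2
  refine ⟨wt', ⟨?_, ?_, ?_, ?_, ?_⟩, ?_⟩
  · intro x
    by_cases h1 : x = o
    · subst h1; omega
    by_cases h2 : x = w
    · subst h2
      have h3 := h.deg_le x
      have := h.weight_eq_zero x
      have := h.weight_le o
      omega
    · rw [hw'x x h1 h2]; exact h.weight_le x
  · intro x
    have h3 := h.deg_le x
    rw [hdeg] at h3
    omega
  · intro x h3
    by_cases h1 : x = o
    · subst h1; omega
    by_cases h2 : x = w
    · subst h2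
      have h3 := h.deg_le x
      omega
    · rw [hw'x x h1 h2]; exact h.weight_eq_zero x (by rw [hdx x h1 h2, h3])
  · apply h.robust.transfer
    intro σ
    refine ⟨Function.update σ o (σ w), ?_, ?_⟩
    · rw [hsize, size_update hdo (by simp)]
      simp [hwo]
    · intro b
      apply hsumf
      · intro x h1 h2
        rw [hw'x x h1 h2]
        simp [h1]
      · rw [hw'o, hw'w]
        simp [hwo]
        split_ifs <;> simp
  · rw [← h.sum_weight]
    apply hsumf _ _ hw'x
    omega
  · unfold potential
    rw [← Finset.sum_add_sum_compl {o, w}, ← Finset.sum_add_sum_compl {o, w} (fun v =>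
        ((if deg (plain (p ::ₘ E)) v = 3 then (1 : ℤ) else 0) -
          if deg (plain (p ::ₘ E)) v = 1 ∧ wt v = 1 then 1 else 0)),
      Finset.sum_pair hwo.symm, Finset.sum_pair hwo.symm]
    have hrest : ∑ i ∈ ({o, w} : Finset V)ᶜ, ((if deg (plain E) i = 3 then (1 : ℤ) else 0) -
          if deg (plain E) i = 1 ∧ wt' i = 1 then 1 else 0) =
        ∑ i ∈ ({o, w} : Finset V)ᶜ, ((if deg (plain (p ::ₘ E)) i = 3 then (1 : ℤ) else 0) -
          if deg (plain (p ::ₘ E)) i = 1 ∧ wt i = 1 then 1 else 0) := by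
      refine Finset.sum_congr rfl fun x hx => ?_
      simp at hx
      rw [hdx x hx.1 hx.2, hw'x x hx.1 hx.2]
    rw [hrest, ho, hdw, hdo, hw'o, hw'w]
    -- the contributions of `o` and `w`: here `a`, `b` are their weights before the contraction and
    -- `d` is the degree of `w` after it
    have key : ∀ a b d : ℕ, a ≤ 1 → b ≤ 1 → 1 + d ≤ 3 → (1 + d = 3 → b = 0) →
        (a + b ≤ max d 1 ∧ (d = 0 → a + b = 0)) →
        ((if 0 = 3 then (1 : ℤ) else 0) - if 0 = 1 ∧ 0 = 1 then 1 else 0) +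
          ((if d = 3 then 1 else 0) - if d = 1 ∧ a + b = 1 then 1 else 0) +
          (if 1 + d = 3 ∧ a = 0 then 1 else 0) ≤
        ((if 1 = 3 then 1 else 0) - if 1 = 1 ∧ a = 1 then 1 else 0) +
          ((if 1 + d = 3 then 1 else 0) - if 1 + d = 1 ∧ b = 1 then 1 else 0) := by
      intro a b d ha hb hd
      have hd : d ≤ 2 := by omega
      interval_cases a <;> interval_cases b <;> interval_cases d <;> simp
    have := key _ _ _ (h.weight_le o) (h.weight_le w) (hdw ▸ h.deg_le w)
      (fun h' => h.weight_eq_zero w (hdw.trans h')) hacc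
    linarith

/-- An admissible graph yields a robust cubic marked graph whose number of vertices is at most
the potential. -/
theorem Admissible.exists_markedGraph {t n : ℕ} (ht : 1 ≤ t) (hn : 4 ≤ n)
    {E : Multiset (V × V)} {wt : V → ℕ} (h : Admissible t n E wt) :
    ∃ G : MarkedGraph, G.IsCubic ∧ G.IsRobust t ∧ G.numMarks = n ∧
      (Fintype.card G.Vertex : ℤ) ≤ potential (plain E) wt := by
  induction hk : E.card using Nat.strong_induction_on generalizing E wt with
  | _ k ih =>
    by_cases hleaf : ∃ o, deg (plain E) o = 1
    · obtain ⟨o, ho⟩ := hleaf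
      obtain ⟨w, p, E', rfl, hwo, hp⟩ := exists_edge_of_deg_eq_one ho
      obtain ⟨wt', h1, h2⟩ := h.contract ht hn hwo hp ho
      obtain ⟨G, hc, hr, hm, hv⟩ := ih E'.card (by rw [← hk]; simp) h1 rfl
      refine ⟨G, hc, hr, hm, ?_⟩
      have : (0 : ℤ) ≤ if deg (plain (p ::ₘ E')) w = 3 ∧ wt o = 0 then 1 else 0 := by positivity
      omega
    · push Not at hleaf
      -- an isolated vertex of weight one would be cut off for free
      have h0 : ∀ v, deg (plain E) v = 0 → wt v = 0 := by
        intro v hv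
        have h1 := size_plain_indicator_le E v v hv
        have h2 := h.robust _ (h1.trans (hv.trans_le t.zero_le))
        have h3 := weightIn_add wt (fun x => decide (x = v ∨ x = v))
        have h4 : weightIn wt (fun x => decide (x = v ∨ x = v)) true = wt v := by
          simp [weightIn]
        have h5 := h.weight_le v
        rw [h.sum_weight] at h3
        omega
      obtain ⟨C, hC, hR, hd⟩ := exists_smooth_all h.weight_le (plain E)
        (fun v => by rw [markCount_plain]; split_ifs with hv; exacts [(h0 v hv).symm, rfl]) h.robust
      have hd3 : ∀ v, deg C v = 3 ↔ deg (plain E) v = 3 := by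
        intro v; rw [hd]; by_cases h2 : deg (plain E) v = 2 <;> simp [h2]
      obtain ⟨G, hc, hr, hm, hv⟩ := exists_markedGraph_of_chains h.weight_le (C := C)
        (fun v => by
          rw [hC]
          split_ifs with h1
          · rfl
          · rw [hd] at h1
            have h2 := h.deg_le v
            have h3 := hleaf v
            have h4 := h.weight_eq_zero v
            split_ifs at h1 <;> omega) hR
        (fun v => by
          have h2 := h.deg_le v
          have h3 := hleaf v
          rw [hd]; split_ifs <;> omega)
        (fun v hv => h.weight_eq_zero v ((hd3 v).1 hv))
      refine ⟨G, hc, hr, hm.trans h.sum_weight, ?_⟩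
      rw [hv, potential]
      simp [hd3, hleaf]

end LeafContraction

/-! ### Amplitudes of phase-free diagrams under bit flips -/

namespace ZXDiagram

open scoped ComplexOrder

variable {n : ℕ}

/-- The labelling condition imposed by a phase-free spider: the legs of a Z-spider carry equal
labels, and an even number of the legs of an X-spider carry `true`. -/
def Compatible (D : ZXDiagram n) (s : D.Spider) (a : D.Edge × Bool → Bool) : Prop :=
  match D.colour s with
  | .Z => ∃ b, ∀ h, D.ends h = Sum.inl s → a h = b
  | .X => Even {h | D.ends h = Sum.inl s ∧ a h = true}.ncard

theorem spiderTensor_Z (D : ZXDiagram n) (s : D.Spider) (a : D.Edge × Bool → Bool)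
    (hc : D.colour s = .Z) (hp : D.phase s = false) :
    0 ≤ D.spiderTensor s a ∧ (D.spiderTensor s a ≠ 0 ↔ D.Compatible s a) := by
  classical
  simp only [spiderTensor, Compatible, hc, hp, ket, Finset.prod_ite_zero]
  simp only [Finset.mem_filter, Finset.mem_univ, true_and, Finset.prod_const_one, if_false,
    Bool.false_eq_true, one_mul, Bool.exists_bool]
  split_ifs <;> simp_all
  norm_num

theorem spiderTensor_X (D : ZXDiagram n) (s : D.Spider) (a : D.Edge × Bool → Bool)
    (hc : D.colour s = .X) (hp : D.phase s = false) :
    0 ≤ D.spiderTensor s a ∧ (D.spiderTensor s a ≠ 0 ↔ D.Compatible s a) := by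
  classical
  simp only [spiderTensor, Compatible, hc, hp, ket, Finset.prod_div_distrib, Finset.prod_const,
    Bool.true_and, Bool.false_and, ← add_div, Bool.false_eq_true, if_false, one_mul]
  rw [Finset.prod_ite, Finset.prod_const, Finset.prod_const_one, mul_one, one_pow]
  have hcard : {h | D.ends h = Sum.inl s ∧ a h = true}.ncard =
      ((Finset.univ.filter fun h => D.ends h = Sum.inl s).filter fun h => a h = true).card := by
    rw [← Set.ncard_coe_finset]
    congr 1
    ext h
    simp
  rw [hcard]
  have hs : (0 : ℂ) < (Real.sqrt 2 : ℂ) ^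
      (Finset.univ.filter fun h => D.ends h = Sum.inl s).card := by
    apply pow_pos
    exact_mod_cast Real.sqrt_pos.2 two_pos
  generalize ((Finset.univ.filter fun h => D.ends h = Sum.inl s).filter
    fun h => a h = true).card = m
  rcases Nat.even_or_odd m with he | ho
  · rw [he.neg_one_pow]
    refine ⟨div_nonneg (by norm_num) hs.le, ?_⟩
    simp only [he, iff_true]
    exact div_ne_zero (by norm_num) hs.ne'
  · rw [ho.neg_one_pow]
    simp [ho]

theorem spiderTensor_spec (D : ZXDiagram n) (s : D.Spider) (a : D.Edge × Bool → Bool)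
    (hp : D.phase s = false) :
    0 ≤ D.spiderTensor s a ∧ (D.spiderTensor s a ≠ 0 ↔ D.Compatible s a) := by
  cases hc : D.colour s with
  | Z => exact spiderTensor_Z D s a hc hp
  | X => exact spiderTensor_X D s a hc hp

/-- A nonvanishing amplitude comes from a labelling that satisfies all local conditions. -/
theorem exists_labelling_of_interp_ne_zero {D : ZXDiagram n} (hD : ∀ s, D.phase s = false)
    {F : D.Fault} {x : Fin n → Bool} (h : D.interp F x ≠ 0) :
    ∃ a : D.Edge × Bool → Bool, (∀ h j, D.ends h = Sum.inr j → a h = x j) ∧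
      (∀ e, (F e).entry (a (e, true)) (a (e, false)) ≠ 0) ∧ ∀ s, D.Compatible s a := by
  classical
  obtain ⟨a, ha, h1⟩ := Finset.exists_ne_zero_of_sum_ne_zero h
  rw [mul_ne_zero_iff, Finset.prod_ne_zero_iff, Finset.prod_ne_zero_iff] at h1
  refine ⟨a, (Finset.mem_filter.1 ha).2, fun e => h1.1 e (Finset.mem_univ _), fun s => ?_⟩
  exact (spiderTensor_spec D s a (hD s)).2.1 (h1.2 s (Finset.mem_univ _))

/-- Conversely, under a bit-flip fault no two contributions can cancel, so that any labelling
that satisfies all local conditions makes the amplitude nonzero. -/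
theorem interp_ne_zero {D : ZXDiagram n} (hD : ∀ s, D.phase s = false)
    {F : D.Fault} (hF : ∀ e, F e = .I ∨ F e = .X) {x : Fin n → Bool}
    {a : D.Edge × Bool → Bool} (ha : ∀ h j, D.ends h = Sum.inr j → a h = x j)
    (h1 : ∀ e, (F e).entry (a (e, true)) (a (e, false)) ≠ 0) (h2 : ∀ s, D.Compatible s a) :
    D.interp F x ≠ 0 := by
  unfold interp
  have hpos : ∀ p : Pauli, (p = .I ∨ p = .X) → ∀ b c, 0 ≤ p.entry b c := by
    rintro p (rfl | rfl) b c <;> simp only [Pauli.entry] <;> split_ifs <;> simp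
  rw [Ne, Finset.sum_eq_zero_iff_of_nonneg]
  · intro h
    have := h a (by simpa using ha)
    rw [mul_eq_zero, Finset.prod_eq_zero_iff, Finset.prod_eq_zero_iff] at this
    rcases this with ⟨e, _, he⟩ | ⟨s, _, hs⟩
    · exact h1 e he
    · exact (spiderTensor_spec D s a (hD s)).2.2 (h2 s) hs
  · intro b _
    exact mul_nonneg (Finset.prod_nonneg fun e _ => hpos _ (hF e) _ _)
      (Finset.prod_nonneg fun s _ => (spiderTensor_spec D s b (hD s)).1)

theorem card_le_weight {D : ZXDiagram n} {F : D.Fault} {S : Finset D.Edge}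
    (h : ∀ e ∈ S, F e ≠ .I) : S.card ≤ D.weight F :=
  Finset.card_le_card fun e he => Finset.mem_filter.2 ⟨Finset.mem_univ _, h e he⟩

/-- A fault on the CAT state acts nontrivially on every output where the label differs from the
common label of the legs of the spider. -/
theorem cat_interp_ne_zero {F : (cat n).Fault} {x : Fin n → Bool} (h : (cat n).interp F x ≠ 0) :
    ∃ b, ∀ j, x j ≠ b → F j ≠ .I := by
  obtain ⟨a, h1, h2, h3⟩ := exists_labelling_of_interp_ne_zero (fun _ => rfl) h
  obtain ⟨b, hb⟩ := h3 ()
  refine ⟨b, fun j hj hF => ?_⟩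
  have h4 := h2 j
  have h5 := hb (j, false) rfl
  have h6 := h1 (j, true) j rfl
  rw [hF, h5, h6] at h4
  simp [Pauli.entry, hj] at h4

/-- A fault on the CAT state with a nonzero amplitude at `x` has at least the weight of one of the
two classes of outputs given by `x`. -/
theorem card_le_weight_of_cat_interp_ne_zero {F : (cat n).Fault} {x : Fin n → Bool}
    (h : (cat n).interp F x ≠ 0) :
    ∃ b, (Finset.univ.filter fun j => x j = b).card ≤ (cat n).weight F := by
  obtain ⟨b, hb⟩ := cat_interp_ne_zero h
  have hS : ∀ j ∈ Finset.univ.filter fun j : Fin n => x j = !b, F j ≠ .I := by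
    intro j hj
    apply hb
    rw [(Finset.mem_filter.1 hj).2]
    simp
  exact ⟨!b, card_le_weight (D := cat n) hS⟩

/-- A diagram that prepares the CAT state has a labelling without faults whose outputs are all
`true`. -/
theorem PreparesCat.exists_labelling {t : ℕ} {D : ZXDiagram n} (hD : ∀ s, D.phase s = false)
    (h : D.PreparesCat t) :
    ∃ u : D.Edge × Bool → Bool, (∀ h j, D.ends h = Sum.inr j → u h = true) ∧
      (∀ e, u (e, true) = u (e, false)) ∧ ∀ s, D.Compatible s u := by
  have hne : (cat n).interp (fun _ => .I) (fun _ => true) ≠ 0 := by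
    refine interp_ne_zero (a := fun _ => true) (fun _ => rfl) (fun _ => Or.inl rfl)
      (fun _ _ _ => rfl) (fun _ => by simp [Pauli.entry]) (fun s => ⟨true, fun _ _ => rfl⟩)
  have hw : (cat n).weight (fun _ => .I) = 0 := by simp [weight]
  obtain ⟨F, hF, c, hc, hs⟩ := h.2 (fun _ => .I) (fun h0 => hne (by rw [h0]; rfl)) (by omega)
  have hFI : F = fun _ => .I := by
    rw [hw] at hF
    have := Finset.card_eq_zero.1 (Nat.le_zero.1 hF)
    funext e
    by_contra he
    have he' : e ∈ Finset.univ.filter fun e => F e ≠ Pauli.I := by simpa using he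
    rw [this] at he'
    simp at he'
  subst hFI
  rw [hs] at hne
  obtain ⟨u, h1, h2, h3⟩ := exists_labelling_of_interp_ne_zero hD (right_ne_zero_of_mul hne)
  exact ⟨u, h1, fun e => by simpa [Pauli.entry] using h2 e, h3⟩

/-! ### The highlighted graph -/

/-- The graph of the edges of a diagram that a labelling highlights, with the spiders and the
outputs as vertices. -/
def highlighted (D : ZXDiagram n) (u : D.Edge × Bool → Bool) :
    Multiset ((D.Spider ⊕ Fin n) × (D.Spider ⊕ Fin n)) :=
  (Finset.univ.filter fun e => u (e, false) = true).val.map fun e =>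
    (D.ends (e, false), D.ends (e, true))

/-- The weights that count the outputs. -/
def outputWeight (D : ZXDiagram n) : D.Spider ⊕ Fin n → ℕ := Sum.elim (fun _ => 0) fun _ => 1

theorem weightIn_outputWeight (D : ZXDiagram n) (σ : D.Spider ⊕ Fin n → Bool)
    (b : Bool) :
    weightIn D.outputWeight σ b = (Finset.univ.filter fun j => σ (Sum.inr j) = b).card := by
  simp [weightIn, outputWeight]

open Classical in
/-- A cut of the highlighted graph gives an undetectable bit-flip fault, whose effect is the flip
of the outputs on one side of the cut. -/
theorem PreparesCat.robust {t : ℕ} {D : ZXDiagram n} (hD : ∀ s, D.phase s = false)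
    (h : D.PreparesCat t) {u : D.Edge × Bool → Bool}
    (hout : ∀ h j, D.ends h = Sum.inr j → u h = true)
    (hu : ∀ e, u (e, true) = u (e, false)) (hs : ∀ s, D.Compatible s u) :
    RobustFor t (size (plain (D.highlighted u))) D.outputWeight := by
  intro σ hσ
  let F : D.Fault := fun e =>
    if u (e, false) = true ∧ σ (D.ends (e, false)) ≠ σ (D.ends (e, true)) then .X else .I
  have hF : D.weight F = size (plain (D.highlighted u)) σ := by
    have h1 : ∀ e, (F e ≠ .I) =
        (u (e, false) = true ∧ σ (D.ends (e, false)) ≠ σ (D.ends (e, true))) := by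
      intro e
      simp only [F]
      split_ifs <;> simp_all
    simp only [size, plain, highlighted, Multiset.map_map, Function.comp_def, Chain.size_edge,
      weight, h1]
    rw [← Finset.filter_filter, Finset.card_filter]
    refine Finset.sum_congr rfl fun e _ => ?_
    split_ifs <;> simp_all
  have hne : D.interp F (fun j => σ (Sum.inr j)) ≠ 0 := by
    refine interp_ne_zero hD (a := fun h => u h && σ (D.ends h)) ?_ ?_ ?_ ?_
    · intro e
      simp only [F]
      split_ifs <;> simp
    · intro h j hj
      simp [hout h j hj, hj]
    · intro e
      simp only [F, hu e]
      split_ifs with h1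
      · obtain ⟨h1, h2⟩ := h1
        simp [h1, Pauli.entry, Ne.symm h2]
      · cases h3 : u (e, false)
        · simp [Pauli.entry]
        · have : σ (D.ends (e, false)) = σ (D.ends (e, true)) := by
            by_contra h4; exact h1 ⟨h3, h4⟩
          simp [Pauli.entry, this]
    · intro s
      have h1 := hs s
      unfold Compatible at h1 ⊢
      cases hc : D.colour s with
      | Z =>
        simp only [hc] at h1 ⊢
        obtain ⟨b, hb⟩ := h1
        exact ⟨b && σ (Sum.inl s), fun h hh => by rw [hb h hh, hh]⟩
      | X =>
        simp only [hc] at h1 ⊢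
        cases h2 : σ (Sum.inl s)
        · have h5 : {h | D.ends h = Sum.inl s ∧ (u h && σ (D.ends h)) = true} = ∅ := by
            rw [Set.eq_empty_iff_forall_notMem]
            rintro h ⟨h3, h4⟩
            simp [h3, h2] at h4
          rw [h5, Set.ncard_empty]
          exact Even.zero
        · convert h1 using 4 with h
          refine and_congr_right fun h3 => ?_
          simp [h3, h2]
  obtain ⟨F₂, hw, c, hc, he⟩ := h.1 F (fun h0 => hne (by rw [h0]; rfl)) (by omega)
  rw [he] at hne
  obtain ⟨b, hb⟩ := card_le_weight_of_cat_interp_ne_zero (right_ne_zero_of_mul hne)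
  rw [weightIn_outputWeight, weightIn_outputWeight, ← hF]
  cases b
  · exact Or.inr (hb.trans hw)
  · exact Or.inl (hb.trans hw)

/-- The spider `s` has exactly `d` legs. -/
def HasLegs {S E ι : Type} (ends : E × Bool → S ⊕ ι) (s : S) (d : ℕ) : Prop :=
  ∃ l : List (E × Bool), l.Nodup ∧ l.length = d ∧ ∀ h, h ∈ l ↔ ends h = Sum.inl s

open Classical in
theorem deg_highlighted (D : ZXDiagram n) {u : D.Edge × Bool → Bool}
    (hu : ∀ e, u (e, true) = u (e, false)) (v : D.Spider ⊕ Fin n) :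
    deg (plain (D.highlighted u)) v = {h | D.ends h = v ∧ u h = true}.ncard := by
  rw [Set.ncard_eq_toFinset_card', Set.toFinset_ofPred, Finset.card_filter, Fintype.sum_prod_type]
  simp only [deg, plain, highlighted, Multiset.map_map, Function.comp_def, Chain.deg_some]
  refine (Finset.sum_filter _ _).trans (Finset.sum_congr rfl fun e _ => ?_)
  rw [Fintype.sum_bool, hu]
  split_ifs <;> simp_all

theorem HasLegs.deg_le {D : ZXDiagram n} {u : D.Edge × Bool → Bool} {s : D.Spider} {d : ℕ}
    (h : HasLegs D.ends s d) : {h | D.ends h = Sum.inl s ∧ u h = true}.ncard ≤ d := by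
  classical
  obtain ⟨l, hl, rfl, h⟩ := h
  rw [← List.toFinset_card_of_nodup hl, ← Set.ncard_coe_finset]
  refine Set.ncard_le_ncard ?_ (Finset.finite_toSet _)
  rintro x ⟨h1, -⟩
  simpa using (h x).2 h1

theorem HasLegs.deg_eq {D : ZXDiagram n} {u : D.Edge × Bool → Bool} {s : D.Spider} {d : ℕ}
    (h : HasLegs D.ends s d) (hu : ∀ h, D.ends h = Sum.inl s → u h = true) :
    {h | D.ends h = Sum.inl s ∧ u h = true}.ncard = d := by
  classical
  obtain ⟨l, hl, rfl, h⟩ := h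
  rw [← List.toFinset_card_of_nodup hl, ← Set.ncard_coe_finset]
  congr 1
  ext x
  simp only [Set.mem_ofPred_eq, List.coe_toFinset, h]
  exact ⟨fun h => h.1, fun h => ⟨h, hu x h⟩⟩

/-- The properties of the diagram of a circuit that the bound rests on, in terms of the data of
the diagram; `T` lists the control spiders of the CNOT gates. The types of spiders and edges are
parameters, so that those of an extended diagram can be given explicitly. -/
structure IsCircuitDiagram {S E : Type} (colour : S → Colour) (phase : S → Bool)
    (ends : E × Bool → S ⊕ Fin n) (T : List S) : Prop where
  phase_eq : ∀ s, phase s = false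
  legs : ∀ s, HasLegs ends s 1 ∨ HasLegs ends s 3 ∧ (colour s = .X ∨ s ∈ T)
  /-- Without CNOT gates every output wire starts at a preparation. -/
  output_of_nil : T = [] → ∀ e b j, ends (e, b) = Sum.inr j →
    ∃ s, ends (e, !b) = Sum.inl s ∧ HasLegs ends s 1
  /-- The control wire of the first CNOT gate starts at a preparation. -/
  first : T ≠ [] → ∃ s ∈ T, colour s = .Z ∧ HasLegs ends s 3 ∧ ∃ e b s',
    ends (e, b) = Sum.inl s ∧ ends (e, !b) = Sum.inl s' ∧ HasLegs ends s' 1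

open Classical in
/-- The diagram of a circuit that prepares the CAT state yields a robust cubic marked graph, whose
vertices and marks use up all but at least one of the control spiders. -/
theorem IsCircuitDiagram.exists_markedGraph {t : ℕ} (ht : 1 ≤ t) (hn : 4 ≤ n) {D : ZXDiagram n}
    {T : List D.Spider} (hD : IsCircuitDiagram D.colour D.phase D.ends T) (h : D.PreparesCat t) :
    ∃ G : MarkedGraph, G.IsCubic ∧ G.IsRobust t ∧ G.numMarks = n ∧
      Fintype.card G.Vertex + n + 1 ≤ T.length := by
  obtain ⟨u, hout, hu, hs⟩ := h.exists_labelling hD.phase_eq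
  have hdeg := D.deg_highlighted hu
  -- the degrees of the highlighted graph
  have hdout : ∀ j, deg (plain (D.highlighted u)) (Sum.inr j) = 1 := by
    intro j
    obtain ⟨x, hx, hx'⟩ := D.output_unique j
    rw [hdeg, Set.ncard_eq_one]
    refine ⟨x, Set.ext fun y => ⟨fun hy => hx' y hy.1, ?_⟩⟩
    rintro rfl
    exact ⟨hx, hout _ _ hx⟩
  have hdle : ∀ s, deg (plain (D.highlighted u)) (Sum.inl s) ≤ 3 := by
    intro s
    rw [hdeg]
    rcases hD.legs s with h1 | h1
    · exact h1.deg_le.trans (by norm_num)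
    · exact h1.1.deg_le
  have hd3 : ∀ s, deg (plain (D.highlighted u)) (Sum.inl s) = 3 → s ∈ T := by
    intro s h3
    rw [hdeg] at h3
    rcases hD.legs s with h1 | ⟨h1, h2 | h2⟩
    · have := h1.deg_le (u := u)
      omega
    -- the degree of an X-spider is even
    · have := hs s
      simp only [Compatible, h2, h3] at this
      exact absurd this (by decide)
    · exact h2
  have hadm : Admissible t n (D.highlighted u) D.outputWeight :=
    { weight_le := by rintro (s | j) <;> simp [outputWeight]
      deg_le := by
        rintro (s | j)
        · exact hdle s
        · rw [hdout]; norm_num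
      weight_eq_zero := by
        rintro (s | j) h3
        · rfl
        · rw [hdout] at h3; omega
      robust := h.robust hD.phase_eq hout hu hs
      sum_weight := by simp [outputWeight] }
  have hpot : potential (plain (D.highlighted u)) D.outputWeight =
      ((Finset.univ.filter fun s =>
        deg (plain (D.highlighted u)) (Sum.inl s) = 3).card : ℤ) - n := by
    simp [potential, outputWeight, hdout, sub_eq_add_neg]
  have hcard : (Finset.univ.filter fun s =>
      deg (plain (D.highlighted u)) (Sum.inl s) = 3).card ≤ T.length :=
    (Finset.card_le_card fun s hs => by simpa using hd3 s (by simpa using hs)).trans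
      T.toFinset_card_le
  by_cases hT : T = []
  -- without CNOT gates the potential would be `-n`
  · obtain ⟨G, -, -, -, hG⟩ := hadm.exists_markedGraph ht hn
    rw [hT, List.length_nil] at hcard
    omega
  obtain ⟨s, hsT, hsZ, hs3, e, b, s', he, he', hs'⟩ := hD.first hT
  have hZ := hs s
  simp only [Compatible, hsZ] at hZ
  obtain ⟨c, hc⟩ := hZ
  have heu : ∀ b', u (e, b') = c := by
    intro b'
    have h1 := hc _ he
    have h2 := hu e
    cases b <;> cases b' <;> simp_all
  cases c with
  | false =>
    -- the control of the first gate is not highlighted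
    obtain ⟨G, hcub, hr, hm, hG⟩ := hadm.exists_markedGraph ht hn
    refine ⟨G, hcub, hr, hm, ?_⟩
    have h0 : deg (plain (D.highlighted u)) (Sum.inl s) = 0 := by
      rw [hdeg, Set.ncard_eq_zero, Set.eq_empty_iff_forall_notMem]
      rintro x ⟨h1, h2⟩
      rw [hc x h1] at h2
      simp at h2
    have hsub : (Finset.univ.filter fun s => deg (plain (D.highlighted u)) (Sum.inl s) = 3) ⊆
        T.toFinset.erase s := by
      intro x hx
      have hx3 : deg (plain (D.highlighted u)) (Sum.inl x) = 3 := by simpa using hx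
      refine Finset.mem_erase.2 ⟨?_, List.mem_toFinset.2 (hd3 x hx3)⟩
      rintro rfl
      omega
    have h1 := Finset.card_le_card hsub
    rw [Finset.card_erase_of_mem (List.mem_toFinset.2 hsT)] at h1
    have h2 := T.toFinset_card_le
    have h3 := List.length_pos_iff.2 hT
    omega
  | true =>
    -- the preparation of its control wire is a leaf of weight zero
    have hE : ∃ p E', D.highlighted u = p ::ₘ E' ∧
        (p = (Sum.inl s', Sum.inl s) ∨ p = (Sum.inl s, Sum.inl s')) := by
      have hmem : (D.ends (e, false), D.ends (e, true)) ∈ D.highlighted u :=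
        Multiset.mem_map_of_mem _ (by simpa using heu false)
      obtain ⟨E', hE'⟩ := Multiset.exists_cons_of_mem hmem
      refine ⟨_, E', hE', ?_⟩
      cases b <;> simp_all
    obtain ⟨p, E', hE, hp⟩ := hE
    have hs1 : deg (plain (D.highlighted u)) (Sum.inl s') = 1 := by
      rw [hdeg]
      refine hs'.deg_eq fun x hx => ?_
      obtain ⟨l, -, hl1, hl⟩ := hs'
      obtain ⟨y, rfl⟩ := List.length_eq_one_iff.1 hl1
      have h1 := List.mem_singleton.1 ((hl _).2 hx)
      have h2 := List.mem_singleton.1 ((hl _).2 he')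
      rw [h1, ← h2, heu]
    have hs3' : deg (plain (D.highlighted u)) (Sum.inl s) = 3 := by
      rw [hdeg]
      exact hs3.deg_eq hc
    rw [hE] at hadm
    obtain ⟨wt, hadm', hpot'⟩ := hadm.contract ht hn (o := Sum.inl s') (w := Sum.inl s)
      (by rintro h1; rw [h1] at hs3'; omega) hp (hE ▸ hs1)
    obtain ⟨G, hcub, hr, hm, hG⟩ := hadm'.exists_markedGraph ht hn
    refine ⟨G, hcub, hr, hm, ?_⟩
    rw [← hE, if_pos ⟨hs3', rfl⟩] at hpot'
    omega

/-! ### Diagrams of circuits -/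

variable {S E S' E' : Type} {colour : S → Colour} {phase : S → Bool} {ends : E × Bool → S ⊕ Fin n}
  {T : List S}

/-- Leg counts are kept by an embedding of diagrams. -/
theorem HasLegs.map {m : ℕ} {f : E' × Bool → S' ⊕ Fin m} {s : S} {s' : S'} {d : ℕ}
    (h : HasLegs ends s d) (i : E → E') (hi : i.Injective)
    (h1 : ∀ e b, f (i e, b) = Sum.inl s' ↔ ends (e, b) = Sum.inl s)
    (h2 : ∀ e b, f (e, b) = Sum.inl s' → e ∈ Set.range i) : HasLegs f s' d := by
  obtain ⟨l, hl1, hl2, hl3⟩ := h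
  refine ⟨l.map (Prod.map i id), hl1.map (hi.prodMap Function.injective_id), by simpa using hl2, ?_⟩
  rintro ⟨e, b⟩
  simp only [List.mem_map, hl3, Prod.exists, Prod.map_apply, id, Prod.mk.injEq]
  constructor
  · rintro ⟨e, b, he, rfl, rfl⟩
    exact (h1 e b).2 he
  · intro he
    obtain ⟨e, rfl⟩ := h2 e b he
    exact ⟨e, b, (h1 e b).1 he, rfl, rfl⟩

theorem isCircuitDiagram_empty :
    IsCircuitDiagram empty.colour empty.phase empty.ends [] where
  phase_eq s := s.elim
  legs s := s.elim
  output_of_nil _ _ _ j := j.elim0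
  first h := absurd rfl h

/-- Addition of a preparation; `f` is the map of half-edges to spiders and outputs of the new
diagram. -/
theorem IsCircuitDiagram.prep (h : IsCircuitDiagram colour phase ends T) (k : Colour)
    {f : Option E × Bool → Option S ⊕ Fin (n + 1)}
    (h1 : ∀ e b, f (some e, b) = Sum.map some Fin.castSucc (ends (e, b)))
    (h2 : f (none, false) = Sum.inl none) (h3 : f (none, true) = Sum.inr (Fin.last n)) :
    IsCircuitDiagram (fun s : Option S => s.elim k colour) (fun s => s.elim false phase) f
      (T.map some) := by
  have hold : ∀ {s d}, HasLegs ends s d → HasLegs f (some s) d := by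
    intro s d h
    refine h.map some (Option.some_injective _) (fun e b => ?_) fun e b he => ?_
    · rw [h1]
      cases hd : ends (e, b) <;> simp
    · cases e with
      | none => cases b <;> simp [h2, h3] at he
      | some e => exact ⟨e, rfl⟩
  have hnew : HasLegs f none 1 := by
    refine ⟨[(none, false)], by simp, rfl, ?_⟩
    rintro ⟨_ | e, b⟩
    · cases b <;> simp [h2, h3]
    · rw [h1]
      cases hd : ends (e, b) <;> simp
  refine ⟨?_, ?_, ?_, ?_⟩
  · rintro (_ | s)
    · rfl
    · exact h.phase_eq s
  · rintro (_ | s)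
    · exact Or.inl hnew
    · exact (h.legs s).imp hold fun h => ⟨hold h.1, by simpa using h.2⟩
  · rintro hT (_ | e) b j hj
    · cases b
      · simp [h2] at hj
      · exact ⟨none, h2, hnew⟩
    · cases hd : ends (e, b) with
      | inl s => simp [h1, hd] at hj
      | inr i =>
        obtain ⟨s, h4, h5⟩ := h.output_of_nil (List.map_eq_nil_iff.1 hT) e b i hd
        exact ⟨some s, by simp [h1, h4], hold h5⟩
  · intro hT
    obtain ⟨s, hs, h4, h5, e, b, s', h6, h7, h8⟩ := h.first (by simpa using hT)
    exact ⟨some s, by simpa using hs, h4, hold h5, some e, b, some s', by simp [h1, h6],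
      by simp [h1, h7], hold h8⟩

/-- Post-selection of an output; `f` is the map of half-edges to spiders and outputs of the new
diagram. -/
theorem IsCircuitDiagram.effect {ends : E × Bool → S ⊕ Fin (n + 1)}
    (h : IsCircuitDiagram colour phase ends T) (k : Colour) {q : Fin (n + 1)}
    (hq : ∃! x, ends x = Sum.inr q) {f : E × Bool → Option S ⊕ Fin n}
    (h1 : ∀ x, f x = Sum.elim (fun s => Sum.inl (some s))
      (q.insertNth (α := fun _ => Option S ⊕ Fin n) (Sum.inl none) Sum.inr) (ends x)) :
    IsCircuitDiagram (fun s : Option S => s.elim k colour) (fun s => s.elim false phase) f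
      (T.map some) := by
  have hold : ∀ {s d}, HasLegs ends s d → HasLegs f (some s) d := by
    intro s d h
    refine h.map id Function.injective_id (fun e b => ?_) fun e _ _ => ⟨e, rfl⟩
    rw [h1, id]
    cases hd : ends (e, b) with
    | inl s => simp
    | inr i => cases i using Fin.succAboveCases q <;> simp
  have hnew : HasLegs f none 1 := by
    obtain ⟨x, hx, hu⟩ := hq
    refine ⟨[x], by simp, rfl, fun y => ?_⟩
    rw [List.mem_singleton]
    constructor
    · rintro rfl
      simp [h1, hx]
    · intro hy
      apply hu
      rw [h1] at hy
      cases hd : ends y with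
      | inl s => simp [hd] at hy
      | inr i =>
        rw [hd] at hy
        cases i using Fin.succAboveCases q with
        | x => rfl
        | p i => simp at hy
  refine ⟨?_, ?_, ?_, ?_⟩
  · rintro (_ | s)
    · rfl
    · exact h.phase_eq s
  · rintro (_ | s)
    · exact Or.inl hnew
    · exact (h.legs s).imp hold fun h => ⟨hold h.1, by simpa using h.2⟩
  · intro hT e b j hj
    cases hd : ends (e, b) with
    | inl s => simp [h1, hd] at hj
    | inr i =>
      obtain ⟨s, h4, h5⟩ := h.output_of_nil (List.map_eq_nil_iff.1 hT) e b i hd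
      exact ⟨some s, by simp [h1, h4], hold h5⟩
  · intro hT
    obtain ⟨s, hs, h4, h5, e, b, s', h6, h7, h8⟩ := h.first (by simpa using hT)
    exact ⟨some s, by simpa using hs, h4, hold h5, e, b, some s', by simp [h1, h6],
      by simp [h1, h7], hold h8⟩

/-- Addition of a CNOT gate; `f` is the map of half-edges to spiders and outputs of the new
diagram. -/
theorem IsCircuitDiagram.cnot (h : IsCircuitDiagram colour phase ends T) {c t : Fin n}
    (hct : c ≠ t) (hout : ∀ j, ∃! x, ends x = Sum.inr j)
    {f : (E ⊕ Option Colour) × Bool → (S ⊕ Colour) ⊕ Fin n}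
    (h1 : ∀ e b, f (Sum.inl e, b) = Sum.elim (fun s => Sum.inl (Sum.inl s))
        (fun j => if j = c then Sum.inl (Sum.inr .Z) else
          if j = t then Sum.inl (Sum.inr .X) else Sum.inr j) (ends (e, b)))
    (h2 : ∀ b, f (Sum.inr none, b) = Sum.inl (Sum.inr (if b then .X else .Z)))
    (h3 : ∀ k, f (Sum.inr (some k), false) = Sum.inl (Sum.inr k))
    (h4 : ∀ k, ∃ j, f (Sum.inr (some k), true) = Sum.inr j) :
    IsCircuitDiagram (Sum.elim colour id) (Sum.elim phase fun _ => false) f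
      (Sum.inr Colour.Z :: T.map Sum.inl) := by
  have hold : ∀ {s d}, HasLegs ends s d → HasLegs f (Sum.inl s) d := by
    intro s d h
    refine h.map Sum.inl Sum.inl_injective (fun e b => ?_) fun e b he => ?_
    · rw [h1]
      cases hd : ends (e, b) with
      | inl s => simp
      | inr j =>
        simp only [Sum.elim_inr]
        split_ifs <;> simp
    · rcases e with e | _ | k
      · exact ⟨e, rfl⟩
      · simp [h2] at he
      · obtain ⟨j, hj⟩ := h4 k
        cases b <;> simp [h3, hj] at he
  have hnew : ∀ k, HasLegs f (Sum.inr k) 3 := by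
    intro k
    obtain ⟨⟨e, b⟩, hx, hu⟩ := hout (if k = .Z then c else t)
    refine ⟨[(Sum.inl e, b), (Sum.inr none, k = .X), (Sum.inr (some k), false)], by simp, rfl, ?_⟩
    rintro ⟨e' | _ | k', b'⟩
    · rw [h1]
      have hu' := hu (e', b')
      simp only [Prod.mk.injEq] at hu'
      simp only [List.mem_cons, Prod.mk.injEq, Sum.inl.injEq, reduceCtorEq, false_and, or_false,
        List.not_mem_nil]
      constructor
      · rintro ⟨rfl, rfl⟩
        rw [hx]
        cases k <;> simp [hct.symm]
      · intro h
        apply hu'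
        cases hd : ends (e', b') with
        | inl s => simp [hd] at h
        | inr j =>
          rw [hd] at h
          simp only [Sum.elim_inr] at h
          cases k <;> split_ifs at h <;> simp_all
    · cases k <;> cases b' <;> simp [h2]
    · obtain ⟨j, hj⟩ := h4 k'
      cases b' <;> simp [h3, hj]
  refine ⟨?_, ?_, ?_, ?_⟩
  · rintro (s | k)
    · exact h.phase_eq s
    · rfl
  · rintro (s | k)
    · exact (h.legs s).imp hold fun h => ⟨hold h.1, by simpa using h.2⟩
    · refine Or.inr ⟨hnew k, ?_⟩
      cases k <;> simp
  · intro hT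
    simp at hT
  · intro _
    by_cases hT : T = []
    · obtain ⟨⟨e, b⟩, hx, -⟩ := hout c
      obtain ⟨s', h5, h6⟩ := h.output_of_nil hT e b c hx
      exact ⟨Sum.inr .Z, by simp, rfl, hnew .Z, Sum.inl e, b, Sum.inl s', by simp [h1, hx],
        by simp [h1, h5], hold h6⟩
    · obtain ⟨s, hs, h5, h6, e, b, s', h7, h8, h9⟩ := h.first hT
      exact ⟨Sum.inl s, by simpa using hs, h5, hold h6, Sum.inl e, b, Sum.inl s', by simp [h1, h7],
        by simp [h1, h8], hold h9⟩

end ZXDiagram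

theorem Circuit.exists_isCircuitDiagram {m n : ℕ} (C : Circuit m n) :
    ∃ T : List C.diagram.Spider, ZXDiagram.IsCircuitDiagram C.diagram.colour C.diagram.phase
      C.diagram.ends T ∧ T.length = C.cnotCount := by
  induction C with
  | nil => exact ⟨[], ZXDiagram.isCircuitDiagram_empty, rfl⟩
  | prep C k ih =>
    obtain ⟨T, h1, h2⟩ := ih
    cases k
    all_goals
      exact ⟨T.map some, h1.prep _ (fun _ b => by cases b <;> rfl) rfl rfl,
        (List.length_map _).trans h2⟩
  | cnot C c t hct ih =>
    obtain ⟨T, h1, h2⟩ := ih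
    exact ⟨Sum.inr Colour.Z :: T.map Sum.inl, h1.cnot hct C.diagram.output_unique
      (fun _ b => by cases b <;> rfl) (fun b => by cases b <;> rfl) (fun _ => rfl)
      (fun k => by cases k; exacts [⟨c, rfl⟩, ⟨t, rfl⟩]),
      congrArg (· + 1) ((List.length_map _).trans h2)⟩
  | measure C k q ih =>
    obtain ⟨T, h1, h2⟩ := ih
    cases k
    all_goals
      exact ⟨T.map some, h1.effect _ (C.diagram.output_unique q) (fun _ => rfl),
        (List.length_map _).trans h2⟩
  | correct C k q f hf ih => exact ih

/-! ### The bound on the number of CNOT gates -/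

theorem GenCNOTCircuit.le_cnotCount {t n : ℕ} (ht : 1 ≤ t) (hn : 4 ≤ n) (C : GenCNOTCircuit n)
    (hC : C.PreparesCat t) :
    (n : ℝ≥0∞) * (minVertexRatio t n + 1) + 1 ≤ (C.cnotCount : ℝ≥0∞) := by
  obtain ⟨T, hT, hlen⟩ := C.circuit.exists_isCircuitDiagram
  obtain ⟨G, hcub, hrob, hmarks, hcard⟩ := hT.exists_markedGraph ht hn hC
  have hn0 : (n : ℝ≥0∞) ≠ 0 := by
    rw [Nat.cast_ne_zero]; omega
  have hmin : minVertexRatio t n ≤ G.vertexRatio := sInf_le ⟨G, hcub, hrob, hmarks, rfl⟩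
  calc (n : ℝ≥0∞) * (minVertexRatio t n + 1) + 1 ≤ n * (G.vertexRatio + 1) + 1 := by gcongr
    _ = Fintype.card G.Vertex + n + 1 := by
      rw [MarkedGraph.vertexRatio, hmarks, mul_add, mul_one,
        ENNReal.mul_div_cancel hn0 (ENNReal.natCast_ne_top n)]
    _ ≤ C.cnotCount := by
      rw [GenCNOTCircuit.cnotCount, ← hlen]
      exact_mod_cast hcard

end CatPrep

theorem mainTheorem3 (t : ℕ) (ht : 1 ≤ t) :
    (∀ n : ℕ, 4 ≤ n → ∀ C : CatPrep.GenCNOTCircuit n, C.PreparesCat t →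
      (n : ENNReal) * (CatPrep.minVertexRatio t n + 1) + 1 ≤ (C.cnotCount : ENNReal)) ∧
    (∀ n : ℕ, 4 ≤ n → CatPrep.optVertexRatio t ≤ CatPrep.minVertexRatio t n →
      ∀ C : CatPrep.GenCNOTCircuit n, C.PreparesCat t →
        (CatPrep.optVertexRatio t + 1) * (n : ENNReal) + 1 ≤ (C.cnotCount : ENNReal)) ∧
    (∀ r : ENNReal, r < CatPrep.optVertexRatio t → ∀ᶠ n : ℕ in Filter.atTop,
      ∀ C : CatPrep.GenCNOTCircuit n, C.PreparesCat t →
        (r + 1) * (n : ENNReal) + 1 ≤ (C.cnotCount : ENNReal)) := by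
  have of_le : ∀ (r : ENNReal) (n : ℕ), 4 ≤ n → r ≤ CatPrep.minVertexRatio t n →
      ∀ C : CatPrep.GenCNOTCircuit n, C.PreparesCat t →
        (r + 1) * (n : ENNReal) + 1 ≤ (C.cnotCount : ENNReal) := by
    intro r n hn hr C hC
    refine le_trans ?_ (C.le_cnotCount ht hn hC)
    rw [mul_comm]
    gcongr
  refine ⟨fun n hn C hC => C.le_cnotCount ht hn hC, fun n hn hr => of_le _ n hn hr, fun r hr => ?_⟩
  filter_upwards [Filter.eventually_lt_of_lt_liminf hr, Filter.eventually_ge_atTop 4] with n h1 h2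
  exact of_le r n h2 h1.le
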